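/- Let $(X,d)$ be a metric space and $\Omega\subset X$ a domain (open, connected) with $\partial\Omega=\overline\Omega\setminus\Omega\neq\emptyset$; write $d(x)=d(x,\partial\Omega)$. For $0<\lambda_0\le 1$, $c_0\ge 1$, the domain $\Omega$ is $(\lambda_0,c_0)$-quasiconvex if for every $x\in\Omega$ any two points $y_1,y_2\in B(x,\lambda_0 d(x))$ are joined by a path in $\Omega$ of length at most $c_0\,d(y_1,y_2)$. For $x,y\in\Omega$ let $k(x,y)=\inf_\gamma\int_\gamma \frac{ds(z)}{d(z)}$, the infimum over all rectifiable paths $\gamma$ in $\Omega$ from $x$ to $y$, and $j_\Omega(x,y)=\log\Big(1+\frac{d(x,y)}{\min\{d(x),d(y)\}}\Big)$. For $c\ge 1$, a path $\gamma:[0,1]\to\Omega$ is a $c$-uniform curve if $\ell(\gamma)\le c\,d(\gamma(0),\gamma(1))$ and $\min\{\ell(\gamma|_{[0,t]}),\ell(\gamma|_{[t,1]})\}\le c\,d(\gamma(t))$ for all $t\in[0,1]$; $\Omega$ is $c$-uniform if any two points of $\Omega$ are joined by a $c$-uniform curve. A quasihyperbolic geodesic from $x$ to $y$ is a path $\gamma:[0,1]\to\Omega$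 from $x$ to $y$ such that $k(\gamma(s),\gamma(t))=|s-t|\,k(x,y)<\infty$ for all $s,t\in[0,1]$. **Theorem.** Let $0<\lambda_0\le1$ and $c_0\ge1$. For $(\lambda_0,c_0)$-quasiconvex domains $\Omega$ (with $\partial\Omega\ne\emptyset$) in proper metric spaces $X$, the following conditions are quantitatively equivalent: 1. $\Omega$ is $c$-uniform (for a constant $c\ge1$); 2. $\Omega$ is QH $c$-uniform, i.e. $k(x,y)\le c\,j_\Omega(x,y)$ for all $x,y\in\Omega$ (for a constant $c\ge 1$); 3. $k(x,y)\le c\,j_\Omega(x,y)+c'$ for all $x,y\in\Omega$ (for real constants $c,c'$). Here "quantitatively" means that each of the six implications holds with constants in the conclusion depending only on $\lambda_0$, $c_0$ and the constants in the hypothesis (not on $X$ or $\Omega$); the constants obtained satisfy $c\ge 1$, and also $c'\ge 0$ in (3). Moreover, for every $c\ge1$ there is $C=C(\lambda_0,c_0,c)\ge 1$ such that, if $\Omega$ is QH $c$-uniform, then $\Omega$ is $C$-uniform, any two points of $\Omega$ are joined by a quasihyperbolic geodesic, and every quasihyperbolic geodesic in $\Omega$ is a $C$-uniform curve. -/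

import Mathlib

open Set
open scoped ENNReal

universe u

noncomputable section

namespace QHUniform

variable {X : Type u} [MetricSpace X]

/-- The distance `d(x) = d(x, ∂Ω)` from a point to the boundary of `Ω`. (For an open set the frontier
is `closure Ω \ Ω`.) -/
def bdist (Ω : Set X) (x : X) : ℝ :=
  Metric.infDist x (frontier Ω)

/-- `γ` restricted to `[0,1]` is a path (continuous map) in `Ω` from `x` to `y`. -/
structure IsPathIn (Ω : Set X) (x y : X) (γ : ℝ → X) : Prop where
  continuousOn : ContinuousOn γ (Icc 0 1)
  mapsTo : MapsTo γ (Icc 0 1) Ω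
  source : γ 0 = x
  target : γ 1 = y

/-- The length `ℓ(γ|[a,b])`: the supremum of the sums `∑ d(γ(tᵢ), γ(tᵢ₊₁))` over subdivisions. -/
def len (γ : ℝ → X) (a b : ℝ) : ℝ≥0∞ :=
  eVariationOn γ (Icc a b)

/-- The line integral `∫_γ ρ ds` along a rectifiable path `γ` on `[0,1]`: the integral of `ρ` along
the arc length parametrization of `γ`, over `[0, ℓ(γ)]`. -/
def lineIntegral (ρ : X → ℝ≥0∞) (γ : ℝ → X) : ℝ≥0∞ :=
  ∫⁻ s in Icc 0 (len γ 0 1).toReal, ρ (naturalParameterization γ (Icc 0 1) 0 s)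

/-- The quasihyperbolic distance `k(x,y) = inf_γ ∫_γ ds / d(z)`, the infimum over all rectifiable
paths `γ` in `Ω` from `x` to `y` (with value `∞` if there is none). -/
def qhDist (Ω : Set X) (x y : X) : ℝ≥0∞ :=
  ⨅ (γ : ℝ → X) (_ : IsPathIn Ω x y γ) (_ : len γ 0 1 ≠ ∞),
    lineIntegral (fun z => (ENNReal.ofReal (bdist Ω z))⁻¹) γ

/-- The relative distance `r_Ω(x,y) = d(x,y) / min(d(x), d(y))`. -/
def rDist (Ω : Set X) (x y : X) : ℝ :=
  dist x y / min (bdist Ω x) (bdist Ω y)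

/-- `j_Ω(x,y) = log (1 + r_Ω(x,y))`. -/
def jDist (Ω : Set X) (x y : X) : ℝ :=
  Real.log (1 + rDist Ω x y)

/-- `Ω` is a domain with non-empty boundary: open, connected, and `∂Ω ≠ ∅`. -/
structure IsDomainWithBoundary (Ω : Set X) : Prop where
  isOpen : IsOpen Ω
  isConnected : IsConnected Ω
  boundary_nonempty : (frontier Ω).Nonempty

/-- `Ω` is a `(lam, c)`-quasiconvex domain (with non-empty boundary): for `x ∈ Ω`, any two points of
the ball `B(x, lam · d(x))` of `X` are joined by a path in `Ω` of length at most `c` times their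
distance. -/
structure IsQuasiconvexDomain (lam c : ℝ) (Ω : Set X) : Prop extends IsDomainWithBoundary Ω where
  exists_path : ∀ x ∈ Ω, ∀ y₁ ∈ Metric.ball x (lam * bdist Ω x),
    ∀ y₂ ∈ Metric.ball x (lam * bdist Ω x),
      ∃ γ : ℝ → X, IsPathIn Ω y₁ y₂ γ ∧ len γ 0 1 ≤ ENNReal.ofReal (c * dist y₁ y₂)

/-- `γ` is a `c`-uniform curve in `Ω` from `x` to `y`. -/
structure IsUniformCurve (c : ℝ) (Ω : Set X) (x y : X) (γ : ℝ → X) : Prop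
    extends IsPathIn Ω x y γ where
  len_le : len γ 0 1 ≤ ENNReal.ofReal (c * dist x y)
  min_len_le : ∀ t ∈ Icc (0 : ℝ) 1,
    min (len γ 0 t) (len γ t 1) ≤ ENNReal.ofReal (c * bdist Ω (γ t))

/-- `Ω` is `c`-uniform: any two of its points are joined by a `c`-uniform curve. -/
def IsUniform (c : ℝ) (Ω : Set X) : Prop :=
  ∀ x ∈ Ω, ∀ y ∈ Ω, ∃ γ : ℝ → X, IsUniformCurve c Ω x y γ

/-- `k ≤ c j_Ω + c'` on `Ω`. -/
def QHBound (c c' : ℝ) (Ω : Set X) : Prop :=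
  ∀ x ∈ Ω, ∀ y ∈ Ω, (qhDist Ω x y : EReal) ≤ ((c * jDist Ω x y + c' : ℝ) : EReal)

/-- `Ω` is QH `c`-uniform: `k ≤ c j_Ω` on `Ω`. -/
def IsQHUniform (c : ℝ) (Ω : Set X) : Prop :=
  ∀ x ∈ Ω, ∀ y ∈ Ω, (qhDist Ω x y : EReal) ≤ ((c * jDist Ω x y : ℝ) : EReal)

/-- `γ` is a quasihyperbolic geodesic in `Ω` from `x` to `y`, i.e. a geodesic of the metric `k`,
parametrized on `[0,1]` proportionally to `k`-arc length. -/
structure IsQHGeodesic (Ω : Set X) (x y : X) (γ : ℝ → X) : Prop extends IsPathIn Ω x y γ where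
  ne_top : qhDist Ω x y ≠ ∞
  qhDist_eq : ∀ s ∈ Icc (0 : ℝ) 1, ∀ t ∈ Icc (0 : ℝ) 1,
    qhDist Ω (γ s) (γ t) = ENNReal.ofReal |s - t| * qhDist Ω x y

end QHUniform

end

noncomputable section

namespace QHUniform

open MeasureTheory Filter Topology

/-! Uniform implies QH uniform by integration. On a `c`-uniform curve, `d ≥ d(x) - s` at arc length
`s` from `x`, and `c d ≥ s` on the part where the initial piece is the shorter one in the cigar
condition; hence `d(x) + s ≤ 3c d` there, and similarly from `y`. Integrating `1/d` yields two
logarithms, each at most `c j` by Bernoulli's inequality.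

The additive constant in (3) matters only where `j` is small. There quasiconvexity alone gives `k ≤
4c₀ j`; elsewhere `j` is bounded below and absorbs `c'`.

From QH uniform to uniform, properness and quasiconvexity give geodesics of `k` as limits of almost
minimizing paths. Let `D` be the boundary distance along a geodesic. If `D ≤ M` on a piece of
quasihyperbolic length `h`, its length is at most `h M`; if moreover `D ≥ M/2` at its ends, then `h
≤ c log(1 + 2h)`, so `h ≤ A = 8c² + 1` (`GeodesicProfile.mul_sub_le`). Cutting the geodesic where
`D` doubles on the way to a running maximum gives pieces whose lengths sum geometrically
(`length_le_of_forall_le`). This yields the cigar condition (`min_length_le`). For the total length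
(`length_le`), the geodesic is cut where `D` first and last reaches `δ = d(x,y)`: the end pieces
have length at most `2Aδ`, and QH uniformity controls the middle piece. -/

/-! ### Real estimates along a quasihyperbolic geodesic -/

theorem exists_first_ge {D : ℝ → ℝ} {a b v : ℝ} (hab : a ≤ b) (hD : ContinuousOn D (Icc a b))
    (hv : v ≤ D b) : ∃ s ∈ Icc a b, v ≤ D s ∧ (∀ u, a ≤ u → u < s → D u < v) ∧
      (s = a ∨ D s = v) := by
  have hcl : IsCompact (Icc a b ∩ D ⁻¹' Ici v) :=
    isCompact_Icc.of_isClosed_subset (hD.preimage_isClosed_of_isClosed isClosed_Icc isClosed_Ici)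
      inter_subset_left
  obtain ⟨s, ⟨hs, hsv⟩, hmin⟩ := hcl.exists_isLeast ⟨b, right_mem_Icc.2 hab, hv⟩
  have hfirst : ∀ u, a ≤ u → u < s → D u < v := fun u hu hus => by
    by_contra hcon
    exact hus.not_ge (hmin ⟨⟨hu, hus.le.trans hs.2⟩, not_lt.1 hcon⟩)
  refine ⟨s, hs, hsv, hfirst, ?_⟩
  by_contra! hcon
  have has : a < s := lt_of_le_of_ne hs.1 (Ne.symm hcon.1)
  obtain ⟨u, hu, hue⟩ := intermediate_value_Icc hs.1 (hD.mono (Icc_subset_Icc_right hs.2))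
    ⟨(hfirst a le_rfl has).le, hsv⟩
  have hus : u < s := lt_of_le_of_ne hu.2 fun h => hcon.2 (h ▸ hue)
  exact (hfirst u hu.1 hus).ne hue

theorem le_of_le_mul_log {c h : ℝ} (hc : 0 ≤ c) (hh : 0 ≤ h)
    (hle : h ≤ c * Real.log (1 + 2 * h)) : h ≤ 8 * c ^ 2 + 1 := by
  have hpos : 0 < 1 + 2 * h := by linarith
  -- This is `log z ≤ z - 1` at `z = √(1 + 2h)`; the square root makes the resulting bound sublinear
  -- in `h`.
  have hlog : Real.log (1 + 2 * h) ≤ 2 * √(1 + 2 * h) := by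
    have h1 := Real.log_le_sub_one_of_pos (Real.sqrt_pos.2 hpos)
    rw [Real.log_sqrt hpos.le] at h1
    linarith
  have hle2 : h ≤ 2 * c * √(1 + 2 * h) := by nlinarith
  have hsq : h ^ 2 ≤ 4 * c ^ 2 * (1 + 2 * h) := by
    calc h ^ 2 ≤ (2 * c * √(1 + 2 * h)) ^ 2 := by gcongr
      _ = 4 * c ^ 2 * (√(1 + 2 * h)) ^ 2 := by ring
      _ = _ := by rw [Real.sq_sqrt hpos.le]
  by_contra! hcon
  nlinarith [sq_nonneg c]

/-- The properties of the distance `D` to the boundary and the arc length `L` along a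
quasihyperbolic geodesic of quasihyperbolic length `K`, whose endpoints are at distance `δ`, in a
quasihyperbolically `c`-uniform domain. -/
structure GeodesicProfile (K c δ : ℝ) (D L : ℝ → ℝ) : Prop where
  K_nonneg : 0 ≤ K
  one_le : 1 ≤ c
  δ_nonneg : 0 ≤ δ
  continuousOn : ContinuousOn D (Icc 0 1)
  pos : ∀ t ∈ Icc (0 : ℝ) 1, 0 < D t
  mono : ∀ s t, 0 ≤ s → s ≤ t → t ≤ 1 → L s ≤ L t
  sub_le : ∀ s t M, 0 ≤ s → s ≤ t → t ≤ 1 → (∀ u ∈ Icc s t, D u ≤ M) →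
    L t - L s ≤ K * (t - s) * M
  le_exp_mul : ∀ s ∈ Icc (0 : ℝ) 1, ∀ t ∈ Icc (0 : ℝ) 1, D s ≤ Real.exp (K * |s - t|) * D t
  exists_gap : ∀ s t, 0 ≤ s → s ≤ t → t ≤ 1 → ∃ e, 0 ≤ e ∧ e ≤ L t - L s ∧
    e ≤ δ + (L s - L 0) + (L 1 - L t) ∧ K * (t - s) ≤ c * Real.log (1 + e / min (D s) (D t))

namespace GeodesicProfile

variable {K c δ : ℝ} {D L : ℝ → ℝ}

/-- Only differences of `L` enter, so the reversed arc length may be normalized as `-L (1 - t)`.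
Reversal transfers every estimate made from the start to the end of the geodesic. -/
theorem reverse (h : GeodesicProfile K c δ D L) :
    GeodesicProfile K c δ (fun t => D (1 - t)) (fun t => -L (1 - t)) where
  K_nonneg := h.K_nonneg
  one_le := h.one_le
  δ_nonneg := h.δ_nonneg
  continuousOn := h.continuousOn.comp (by fun_prop) fun t ht =>
    ⟨by linarith [ht.2], by linarith [ht.1]⟩
  pos t ht := h.pos _ ⟨by linarith [ht.2], by linarith [ht.1]⟩
  mono s t hs hst ht := neg_le_neg (h.mono _ _ (by linarith) (by linarith) (by linarith))
  sub_le s t M hs hst ht hM := by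
    have := h.sub_le (1 - t) (1 - s) M (by linarith) (by linarith) (by linarith) fun u hu => by
      simpa using hM (1 - u) ⟨by linarith [hu.2], by linarith [hu.1]⟩
    rw [show 1 - s - (1 - t) = t - s by ring] at this
    linarith
  le_exp_mul s hs t ht := by
    have := h.le_exp_mul (1 - s) ⟨by linarith [hs.2], by linarith [hs.1]⟩ (1 - t)
      ⟨by linarith [ht.2], by linarith [ht.1]⟩
    rwa [show 1 - s - (1 - t) = t - s by ring, abs_sub_comm] at this
  exists_gap s t hs hst ht := by
    obtain ⟨e, h1, h2, h3, h4⟩ := h.exists_gap (1 - t) (1 - s) (by linarith) (by linarith)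
      (by linarith)
    rw [show 1 - s - (1 - t) = t - s by ring, min_comm] at h4
    refine ⟨e, h1, by linarith, ?_, h4⟩
    rw [sub_self, sub_zero]
    linarith

/-- The bound for the quasihyperbolic length of a piece of the geodesic on which `D` is almost
constant. -/
theorem mul_sub_le (h : GeodesicProfile K c δ D L) {s t M : ℝ} (hs : 0 ≤ s) (hst : s ≤ t)
    (ht : t ≤ 1) (hM : ∀ u ∈ Icc s t, D u ≤ M) (hDs : M / 2 ≤ D s) (hDt : M / 2 ≤ D t) :
    K * (t - s) ≤ 8 * c ^ 2 + 1 := by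
  have hc := h.one_le
  have hh : 0 ≤ K * (t - s) := mul_nonneg h.K_nonneg (sub_nonneg.2 hst)
  have hMpos : 0 < M := (h.pos s ⟨hs, hst.trans ht⟩).trans_le (hM s (left_mem_Icc.2 hst))
  obtain ⟨e, he0, he, -, hle⟩ := h.exists_gap s t hs hst ht
  refine le_of_le_mul_log (by linarith) hh (hle.trans ?_)
  have hm : M / 2 ≤ min (D s) (D t) := le_min hDs hDt
  have h1 : e / min (D s) (D t) ≤ 2 * (K * (t - s)) := by
    rw [div_le_iff₀ (by linarith)]
    have := h.sub_le s t M hs hst ht hM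
    nlinarith
  have h0 : 0 ≤ e / min (D s) (D t) := div_nonneg he0 (by linarith)
  gcongr

/-- Dyadic descent from the maximum: with `A = 8c² + 1`, the piece between the first time `D`
reaches `D t / 2` and `t` has length at most `A D t`, and the same argument applies to what precedes
it with half the maximum. The geometric series sums to `2A D t`. -/
theorem length_le_of_forall_le (h : GeodesicProfile K c δ D L) {t : ℝ} (ht : t ∈ Icc (0 : ℝ) 1)
    (hmax : ∀ u ∈ Icc 0 t, D u ≤ D t) : L t - L 0 ≤ 2 * (8 * c ^ 2 + 1) * D t := by
  have h00 : (0 : ℝ) ∈ Icc (0 : ℝ) 1 := by simp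
  -- `n` bounds the number of halvings before the level drops to `D 0`.
  suffices H : ∀ n : ℕ, ∀ t ∈ Icc (0 : ℝ) 1, (∀ u ∈ Icc 0 t, D u ≤ D t) → D t < 2 ^ n * D 0 →
      L t - L 0 ≤ 2 * (8 * c ^ 2 + 1) * D t by
    obtain ⟨n, hn⟩ := pow_unbounded_of_one_lt (D t / D 0) one_lt_two
    exact H n t ht hmax ((div_lt_iff₀ (h.pos 0 h00)).1 hn)
  intro n
  induction n with
  | zero =>
    intro t ht hmax hlt
    have := hmax 0 (left_mem_Icc.2 ht.1)
    linarith
  | succ n ih =>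
    intro t ht hmax hlt
    have hDt := h.pos t ht
    obtain ⟨s, hs, hsv, hfirst, hcase⟩ := exists_first_ge ht.1
      (h.continuousOn.mono (Icc_subset_Icc_right ht.2)) (v := D t / 2) (by linarith)
    have hM : ∀ u ∈ Icc s t, D u ≤ D t := fun u hu => hmax u ⟨hs.1.trans hu.1, hu.2⟩
    have h1 := h.mul_sub_le hs.1 hs.2 ht.2 hM hsv (by linarith)
    have h2 := h.sub_le s t _ hs.1 hs.2 ht.2 hM
    have h3 : K * (t - s) * D t ≤ (8 * c ^ 2 + 1) * D t := by gcongr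
    rcases hcase with rfl | hcase
    · nlinarith [sq_nonneg c]
    · have h4 := ih s ⟨hs.1, hs.2.trans ht.2⟩ (fun u hu => ?_) ?_
      · rw [hcase] at h4
        linarith
      · rcases hu.2.lt_or_eq with hlt' | rfl
        · rw [hcase]
          exact (hfirst u hu.1 hlt').le
        · exact le_rfl
      · rw [hcase]
        rw [pow_succ] at hlt
        linarith

/-- Before the maximum point `p`, `D u` may dip below the running maximum `D t`, but `D` climbs back
to that level at some `w ≥ u`. Between `t` and `w` the quasihyperbolic length is at most `8c² + 1`,
so `D u` is smaller than `D t` by at most a factor `exp (8c² + 1)`, while the length up to `w` is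
controlled by `D w = D t`. -/
theorem length_le_exp_mul (h : GeodesicProfile K c δ D L) {p u : ℝ} (hp : p ∈ Icc (0 : ℝ) 1)
    (hmax : ∀ u ∈ Icc 0 p, D u ≤ D p) (hu : u ∈ Icc 0 p) :
    L u - L 0 ≤ 2 * (8 * c ^ 2 + 1) * Real.exp (8 * c ^ 2 + 1) * D u := by
  obtain ⟨t, ht, htmax⟩ := isCompact_Icc.exists_isMaxOn (nonempty_Icc.2 hu.1)
    (h.continuousOn.mono (Icc_subset_Icc_right (hu.2.trans hp.2)))
  rw [isMaxOn_iff] at htmax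
  obtain ⟨w, hw, hwv, hfirst, hcase⟩ := exists_first_ge hu.2
    (h.continuousOn.mono (Icc_subset_Icc hu.1 hp.2)) (v := D t) (hmax t ⟨ht.1, ht.2.trans hu.2⟩)
  have hwt : D w = D t := by
    rcases hcase with rfl | hcase
    · exact le_antisymm (htmax _ ⟨hu.1, le_rfl⟩) hwv
    · exact hcase
  have hle : ∀ v ∈ Icc 0 w, D v ≤ D w := by
    intro v hv
    rw [hwt]
    rcases le_total v u with hvu | hvu
    · exact htmax v ⟨hv.1, hvu⟩
    · rcases hv.2.lt_or_eq with hlt | rfl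
      · exact (hfirst v hvu hlt).le
      · exact hwt.le
  have hw1 : w ≤ 1 := hw.2.trans hp.2
  have hw0 : 0 ≤ w := hu.1.trans hw.1
  have hu1 : u ≤ 1 := hu.2.trans hp.2
  have htw : t ≤ w := ht.2.trans hw.1
  have hDt := h.pos t ⟨ht.1, ht.2.trans hu1⟩
  have h1 := h.mul_sub_le ht.1 htw hw1 (M := D t)
    (fun v hv => hwt ▸ hle v ⟨ht.1.trans hv.1, hv.2⟩) (by linarith) (by linarith)
  have h2 := h.le_exp_mul t ⟨ht.1, ht.2.trans hu1⟩ u ⟨hu.1, hu1⟩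
  have h3 : K * |t - u| ≤ 8 * c ^ 2 + 1 := by
    rw [abs_sub_comm, abs_of_nonneg (sub_nonneg.2 ht.2)]
    have : K * (u - t) ≤ K * (w - t) := mul_le_mul_of_nonneg_left (by linarith [hw.1]) h.K_nonneg
    linarith
  have hDu := h.pos u ⟨hu.1, hu1⟩
  have h4 : D t ≤ Real.exp (8 * c ^ 2 + 1) * D u := h2.trans (by gcongr)
  have h5 := h.length_le_of_forall_le ⟨hw0, hw1⟩ hle
  have h6 := h.mono u w hu.1 hw.1 hw1
  rw [hwt] at h5
  calc L u - L 0 ≤ 2 * (8 * c ^ 2 + 1) * D t := by linarith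
    _ ≤ 2 * (8 * c ^ 2 + 1) * (Real.exp (8 * c ^ 2 + 1) * D u) := by gcongr
    _ = _ := by ring

theorem exists_max (h : GeodesicProfile K c δ D L) :
    ∃ p ∈ Icc (0 : ℝ) 1, ∀ u ∈ Icc (0 : ℝ) 1, D u ≤ D p := by
  obtain ⟨p, hp, hmax⟩ := isCompact_Icc.exists_isMaxOn (nonempty_Icc.2 zero_le_one) h.continuousOn
  exact ⟨p, hp, isMaxOn_iff.1 hmax⟩

theorem min_length_le (h : GeodesicProfile K c δ D L) {u : ℝ} (hu : u ∈ Icc (0 : ℝ) 1) :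
    L u - L 0 ≤ 2 * (8 * c ^ 2 + 1) * Real.exp (8 * c ^ 2 + 1) * D u ∨
      L 1 - L u ≤ 2 * (8 * c ^ 2 + 1) * Real.exp (8 * c ^ 2 + 1) * D u := by
  obtain ⟨p, hp, hmax⟩ := h.exists_max
  rcases le_total u p with hup | hpu
  · exact Or.inl (h.length_le_exp_mul hp (fun v hv => hmax v ⟨hv.1, hv.2.trans hp.2⟩) ⟨hu.1, hup⟩)
  · right
    have := h.reverse.length_le_exp_mul (p := 1 - p) (u := 1 - u)
      ⟨by linarith [hp.2], by linarith [hp.1]⟩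
      (fun v hv => by
        simpa using hmax (1 - v) ⟨by linarith [hv.2, hp.1], by linarith [hv.1]⟩)
      ⟨by linarith [hu.2], by linarith⟩
    simp only [sub_sub_cancel, sub_zero] at this
    linarith

theorem exists_first_length_le (h : GeodesicProfile K c δ D L) {p : ℝ} (hp : p ∈ Icc (0 : ℝ) 1)
    (hδ : δ ≤ D p) : ∃ s ∈ Icc 0 p, δ ≤ D s ∧ L s - L 0 ≤ 2 * (8 * c ^ 2 + 1) * δ := by
  obtain ⟨s, hs, hsv, hfirst, hcase⟩ := exists_first_ge hp.1
    (h.continuousOn.mono (Icc_subset_Icc_right hp.2)) hδ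
  refine ⟨s, hs, hsv, ?_⟩
  have hδ0 := h.δ_nonneg
  rcases hcase with rfl | hcase
  · rw [sub_self]
    positivity
  · rw [← hcase]
    refine h.length_le_of_forall_le ⟨hs.1, hs.2.trans hp.2⟩ fun u hu => ?_
    rcases hu.2.lt_or_eq with hlt | rfl
    · exact hcase ▸ (hfirst u hu.1 hlt).le
    · exact le_rfl

theorem length_le (h : GeodesicProfile K c δ D L) :
    L 1 - L 0 ≤ (4 * (8 * c ^ 2 + 1) + Real.exp (c * Real.log (2 + 4 * (8 * c ^ 2 + 1))) *
      c * (1 + 4 * (8 * c ^ 2 + 1))) * δ := by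
  have hc := h.one_le
  have hδ0 := h.δ_nonneg
  set A := 8 * c ^ 2 + 1 with hA
  have hApos : 0 < A := by positivity
  obtain ⟨p, hp, hmax⟩ := h.exists_max
  have hp' : 1 - p ∈ Icc (0 : ℝ) 1 := ⟨by linarith [hp.2], by linarith [hp.1]⟩
  rcases le_total δ (D p) with hδ | hδ
  · obtain ⟨s, hs, hDs, hLs⟩ := h.exists_first_length_le hp hδ
    obtain ⟨t', ht', hDt, hLt⟩ := h.reverse.exists_first_length_le hp' (by simpa using hδ)
    obtain ⟨t, rfl⟩ : ∃ t, t' = 1 - t := ⟨1 - t', by ring⟩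
    simp only [sub_sub_cancel, sub_zero] at hDt hLt
    have hst : s ≤ t := by linarith [hs.2, ht'.2]
    have ht1 : t ≤ 1 := by linarith [ht'.1]
    have hs' : s ∈ Icc (0 : ℝ) 1 := ⟨hs.1, hst.trans ht1⟩
    have ht : t ∈ Icc (0 : ℝ) 1 := ⟨hs.1.trans hst, ht1⟩
    obtain ⟨e, he0, -, he, hle⟩ := h.exists_gap s t hs.1 hst ht1
    set m := min (D s) (D t) with hm
    have hmpos : 0 < m := lt_min (h.pos s hs') (h.pos t ht)
    have hδm : δ ≤ m := le_min hDs hDt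
    have heδ : e ≤ (1 + 4 * A) * δ := by linarith
    have hem0 : 0 ≤ e / m := by positivity
    have hem : e / m ≤ 1 + 4 * A := by
      rw [div_le_iff₀ hmpos]
      exact heδ.trans (by gcongr)
    have hK : K * (t - s) ≤ c * Real.log (2 + 4 * A) := by
      refine hle.trans (mul_le_mul_of_nonneg_left (Real.log_le_log ?_ ?_) ?_) <;> linarith
    -- Here `log (1 + e/m) ≤ e/m` is used instead of `hK`: `m` can be much larger than `δ` when an
    -- endpoint is far from the boundary, and this bound cancels `m`.
    have hKm : K * (t - s) * m ≤ c * (1 + 4 * A) * δ := by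
      have hlog : Real.log (1 + e / m) ≤ e / m := by
        have := Real.log_le_sub_one_of_pos (x := 1 + e / m) (by linarith)
        linarith
      calc K * (t - s) * m ≤ c * (e / m) * m :=
            mul_le_mul_of_nonneg_right (hle.trans (by gcongr)) hmpos.le
        _ = c * e := by field_simp
        _ ≤ c * ((1 + 4 * A) * δ) := by gcongr
        _ = _ := by ring
    have hD : ∀ u ∈ Icc s t, D u ≤ Real.exp (c * Real.log (2 + 4 * A)) * m := by
      have key : ∀ u ∈ Icc s t, ∀ v ∈ Icc s t,
          D u ≤ Real.exp (c * Real.log (2 + 4 * A)) * D v := by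
        intro u hu v hv
        have hu1 : u ∈ Icc (0 : ℝ) 1 := ⟨hs.1.trans hu.1, hu.2.trans ht1⟩
        have hv1 : v ∈ Icc (0 : ℝ) 1 := ⟨hs.1.trans hv.1, hv.2.trans ht1⟩
        refine (h.le_exp_mul u hu1 v hv1).trans ?_
        have hpv := h.pos v hv1
        have habs : |u - v| ≤ t - s := abs_sub_le_iff.2 ⟨by linarith [hu.2, hv.1],
          by linarith [hv.2, hu.1]⟩
        exact mul_le_mul_of_nonneg_right
          (Real.exp_le_exp.2 ((mul_le_mul_of_nonneg_left habs h.K_nonneg).trans hK)) hpv.le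
      intro u hu
      rcases min_choice (D s) (D t) with hms | hmt
      · rw [hm, hms]
        exact key u hu s (left_mem_Icc.2 hst)
      · rw [hm, hmt]
        exact key u hu t (right_mem_Icc.2 hst)
    have hmid := h.sub_le s t _ hs.1 hst ht1 hD
    have hmid' : K * (t - s) * (Real.exp (c * Real.log (2 + 4 * A)) * m) ≤
        Real.exp (c * Real.log (2 + 4 * A)) * c * (1 + 4 * A) * δ := by
      calc K * (t - s) * (Real.exp (c * Real.log (2 + 4 * A)) * m)
          = Real.exp (c * Real.log (2 + 4 * A)) * (K * (t - s) * m) := by ring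
        _ ≤ Real.exp (c * Real.log (2 + 4 * A)) * (c * (1 + 4 * A) * δ) := by gcongr
        _ = _ := by ring
    linarith
  -- Here `D` never exceeds `δ`, so the two halves at the maximum point already have length at most
  -- `2Aδ` each.
  · have h1 := h.length_le_of_forall_le hp fun u hu => hmax u ⟨hu.1, hu.2.trans hp.2⟩
    have h2 := h.reverse.length_le_of_forall_le hp' fun u hu => by
      simpa using hmax (1 - u) ⟨by linarith [hu.2, hp.1], by linarith [hu.1]⟩
    simp only [sub_sub_cancel, sub_zero] at h2
    have h3 : 2 * A * D p ≤ 2 * A * δ := by gcongr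
    have h4 : 0 ≤ Real.exp (c * Real.log (2 + 4 * A)) * c * (1 + 4 * A) * δ := by positivity
    linarith

end GeodesicProfile

/-! ### Arc length, Lipschitz paths and the quasihyperbolic distance -/

variable {X : Type u} [MetricSpace X]

theorem eVariationOn_Icc_le_of_lipschitzOnWith {f : ℝ → X} {K : NNReal} {a b : ℝ}
    (h : LipschitzOnWith K f (Icc a b)) :
    eVariationOn f (Icc a b) ≤ K * ENNReal.ofReal (b - a) := by
  have := h.comp_eVariationOn_le (g := id) (s := Icc a b) (mapsTo_id _)
  rwa [eVariationOn_id_Icc] at this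

/-- Change of variables inequality for a `1`-Lipschitz substitution. -/
theorem setLIntegral_le_of_lipschitzOnWith {v : ℝ → ℝ} {S T : Set ℝ}
    (hv : LipschitzOnWith 1 v S) (hS : MeasurableSet S) (hT : T ⊆ v '' S) (f : ℝ → ℝ≥0∞) :
    ∫⁻ t in T, f t ≤ ∫⁻ s in S, f (v s) := by
  -- It suffices that Lebesgue measure on `T` is dominated by the push-forward under `v` of Lebesgue
  -- measure on `S`. This holds because a `1`-Lipschitz map does not increase one-dimensional
  -- Hausdorff measure.
  refine le_trans ?_ (lintegral_map_le f v)
  refine lintegral_mono' ?_ le_rfl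
  have hm : AEMeasurable v (volume.restrict S) := hv.continuousOn.aemeasurable hS
  refine Measure.le_iff.2 fun B hB => ?_
  rw [Measure.map_apply_of_aemeasurable hm hB, Measure.restrict_apply hB]
  refine le_trans ?_ (Measure.le_restrict_apply S _)
  have h1 : B ∩ T ⊆ v '' (v ⁻¹' B ∩ S) := by
    rintro _ ⟨hb, ht⟩
    obtain ⟨s, hs, rfl⟩ := hT ht
    exact ⟨s, ⟨hb, hs⟩, rfl⟩
  refine (measure_mono h1).trans ?_
  have h2 := (hv.mono (inter_subset_right (s := v ⁻¹' B))).hausdorffMeasure_image_le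
    (d := 1) zero_le_one
  simpa [hausdorffMeasure_real] using h2

theorem locallyBoundedVariationOn_of_len_ne_top {γ : ℝ → X} (hb : len γ 0 1 ≠ ∞) :
    LocallyBoundedVariationOn γ (Icc 0 1) :=
  BoundedVariationOn.locallyBoundedVariationOn hb

/-- The one-sided jumps of the variation function are the jumps of `f`, which vanish. Continuity
makes arc length take every value in `[0, ℓ(γ)]`. -/
theorem continuousOn_variationOnFromTo {f : ℝ → X} {s : Set ℝ} {a : ℝ} (ha : a ∈ s)
    (hf : ContinuousOn f s) (hb : LocallyBoundedVariationOn f s) :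
    ContinuousOn (variationOnFromTo f s a) s := by
  intro b hbs
  have hl := variationOnFromTo.tendsto_left ha hbs hb
    ((hf b hbs).mono_left (nhdsWithin_mono _ inter_subset_left))
  have hr := variationOnFromTo.tendsto_right ha hbs hb
    ((hf b hbs).mono_left (nhdsWithin_mono _ inter_subset_left))
  rw [dist_self, sub_zero] at hl
  rw [dist_self, add_zero] at hr
  have hs : s ⊆ (s ∩ Iio b ∪ s ∩ Ioi b) ∪ {b} := by
    intro z hz
    rcases lt_trichotomy z b with h | h | h
    · exact Or.inl (Or.inl ⟨hz, h⟩)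
    · exact Or.inr h
    · exact Or.inl (Or.inr ⟨hz, h⟩)
  refine ContinuousWithinAt.mono ?_ hs
  refine ContinuousWithinAt.union (ContinuousWithinAt.union hl hr) ?_
  exact continuousWithinAt_singleton

theorem variationOnFromTo_unitInterval {γ : ℝ → X} {t : ℝ} (ht : t ∈ Icc (0 : ℝ) 1) :
    variationOnFromTo γ (Icc 0 1) 0 t = (len γ 0 t).toReal := by
  rw [variationOnFromTo.eq_of_le _ _ ht.1, len, inter_eq_right.2 (Icc_subset_Icc_right ht.2)]

theorem len_add {γ : ℝ → X} {a b c : ℝ} (h₁ : a ≤ b) (h₂ : b ≤ c) :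
    len γ a b + len γ b c = len γ a c := by
  simpa [len] using eVariationOn.Icc_add_Icc γ (s := univ) h₁ h₂ (mem_univ b)

theorem len_mono {γ : ℝ → X} {a b c d : ℝ} (h₁ : c ≤ a) (h₂ : b ≤ d) :
    len γ a b ≤ len γ c d :=
  eVariationOn.mono _ (Icc_subset_Icc h₁ h₂)

theorem image_variationOnFromTo {γ : ℝ → X} (hγ : ContinuousOn γ (Icc 0 1))
    (hb : len γ 0 1 ≠ ∞) :
    variationOnFromTo γ (Icc 0 1) 0 '' Icc 0 1 = Icc 0 (len γ 0 1).toReal := by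
  have hb' := locallyBoundedVariationOn_of_len_ne_top hb
  have h0 : (0 : ℝ) ∈ Icc (0 : ℝ) 1 := by simp
  have h1 : (1 : ℝ) ∈ Icc (0 : ℝ) 1 := by simp
  have hc := continuousOn_variationOnFromTo h0 hγ hb'
  have hm := variationOnFromTo.monotoneOn hb' h0
  have e0 : variationOnFromTo γ (Icc 0 1) 0 0 = 0 := variationOnFromTo.self _ _ _
  have e1 := variationOnFromTo_unitInterval (γ := γ) h1
  apply Subset.antisymm
  · rintro _ ⟨t, ht, rfl⟩
    exact ⟨e0.symm.le.trans (hm h0 ht ht.1), (hm ht h1 ht.2).trans_eq e1⟩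
  · have := intermediate_value_Icc zero_le_one hc
    rwa [e0, e1] at this

/-- A `1`-Lipschitz path in `Ω` from `x` to `y`, defined on `[0, L]`. -/
structure IsLipPath (Ω : Set X) (x y : X) (L : ℝ) (σ : ℝ → X) : Prop where
  nonneg : 0 ≤ L
  dist_le : ∀ r s, 0 ≤ r → r ≤ s → s ≤ L → dist (σ r) (σ s) ≤ s - r
  mapsTo : MapsTo σ (Icc 0 L) Ω
  source : σ 0 = x
  target : σ L = y

/-- The density `1 / d(z)` of the quasihyperbolic metric. -/
def qhDensity (Ω : Set X) (z : X) : ℝ≥0∞ := (ENNReal.ofReal (bdist Ω z))⁻¹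

/-- The quasihyperbolic length of a Lipschitz path on `[0, L]`. -/
def qhLen (Ω : Set X) (L : ℝ) (σ : ℝ → X) : ℝ≥0∞ :=
  ∫⁻ s in Icc 0 L, qhDensity Ω (σ s)

theorem IsLipPath.lipschitzOnWith {Ω : Set X} {x y : X} {L : ℝ} {σ : ℝ → X}
    (h : IsLipPath Ω x y L σ) : LipschitzOnWith 1 σ (Icc 0 L) := by
  refine LipschitzOnWith.of_dist_le_mul fun r hr s hs => ?_
  rw [NNReal.coe_one, one_mul, Real.dist_eq]
  rcases le_total r s with hrs | hrs
  · rw [abs_sub_comm, abs_of_nonneg (sub_nonneg.2 hrs)]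
    exact h.dist_le r s hr.1 hrs hs.2
  · rw [abs_of_nonneg (sub_nonneg.2 hrs), dist_comm]
    exact h.dist_le s r hs.1 hrs hr.2

theorem naturalParameterization_variationOnFromTo {γ : ℝ → X}
    (hb : len γ 0 1 ≠ ∞) {t : ℝ} (ht : t ∈ Icc (0 : ℝ) 1) :
    naturalParameterization γ (Icc 0 1) 0 (variationOnFromTo γ (Icc 0 1) 0 t) = γ t :=
  edist_eq_zero.1 (edist_naturalParameterization_eq_zero
    (locallyBoundedVariationOn_of_len_ne_top hb) (by simp) ht)

theorem exists_eq_naturalParameterization {γ : ℝ → X} (hγ : ContinuousOn γ (Icc 0 1))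
    (hb : len γ 0 1 ≠ ∞) {s : ℝ} (hs : s ∈ Icc 0 (len γ 0 1).toReal) :
    ∃ t ∈ Icc (0 : ℝ) 1, (len γ 0 t).toReal = s ∧
      naturalParameterization γ (Icc 0 1) 0 s = γ t := by
  rw [← image_variationOnFromTo hγ hb] at hs
  obtain ⟨t, ht, rfl⟩ := hs
  exact ⟨t, ht, (variationOnFromTo_unitInterval ht).symm,
    naturalParameterization_variationOnFromTo hb ht⟩

theorem dist_le_len_toReal_sub {γ : ℝ → X} (hb : len γ 0 1 ≠ ∞) {r s : ℝ} (hr : 0 ≤ r)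
    (hrs : r ≤ s) (hs : s ≤ 1) : dist (γ r) (γ s) ≤ (len γ 0 s).toReal - (len γ 0 r).toReal := by
  have h1 := len_add (γ := γ) hr hrs
  have hne : len γ 0 s ≠ ∞ := ne_top_of_le_ne_top hb (len_mono le_rfl hs)
  have hne1 : len γ 0 r ≠ ∞ := ne_top_of_le_ne_top hne (h1 ▸ le_self_add)
  have hne2 : len γ r s ≠ ∞ := ne_top_of_le_ne_top hne (h1 ▸ le_add_self)
  rw [← h1, ENNReal.toReal_add hne1 hne2, add_sub_cancel_left, dist_edist]
  exact ENNReal.toReal_mono hne2 (eVariationOn.edist_le _ (left_mem_Icc.2 hrs) (right_mem_Icc.2 hrs))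

theorem IsPathIn.isLipPath {Ω : Set X} {x y : X} {γ : ℝ → X} (h : IsPathIn Ω x y γ)
    (hb : len γ 0 1 ≠ ∞) :
    IsLipPath Ω x y (len γ 0 1).toReal (naturalParameterization γ (Icc 0 1) 0) := by
  have h0 : (0 : ℝ) ∈ Icc (0 : ℝ) 1 := by simp
  have h1 : (1 : ℝ) ∈ Icc (0 : ℝ) 1 := by simp
  refine ⟨ENNReal.toReal_nonneg, fun r s hr hrs hs => ?_, fun s hs => ?_, ?_, ?_⟩
  · obtain ⟨a, ha, ea, ea'⟩ := exists_eq_naturalParameterization h.continuousOn hb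
      (s := r) ⟨hr, hrs.trans hs⟩
    obtain ⟨b, hb', eb, eb'⟩ := exists_eq_naturalParameterization h.continuousOn hb
      (s := s) ⟨hr.trans hrs, hs⟩
    rw [ea', eb']
    rcases le_total a b with hab | hab
    · rw [← ea, ← eb]
      exact dist_le_len_toReal_sub hb ha.1 hab hb'.2
    · have := dist_le_len_toReal_sub hb hb'.1 hab ha.2
      rw [dist_comm]
      linarith
  · obtain ⟨a, ha, -, ea'⟩ := exists_eq_naturalParameterization h.continuousOn hb hs
    rw [ea']
    exact h.mapsTo ha
  · have := naturalParameterization_variationOnFromTo hb h0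
    rwa [variationOnFromTo.self, h.source] at this
  · have := naturalParameterization_variationOnFromTo hb h1
    rwa [variationOnFromTo_unitInterval h1, h.target] at this

theorem exists_isLipPath_of_qhDist_lt {Ω : Set X} {x y : X} {a : ℝ≥0∞}
    (h : qhDist Ω x y < a) : ∃ L σ, IsLipPath Ω x y L σ ∧ qhLen Ω L σ < a := by
  simp only [qhDist, iInf_lt_iff] at h
  obtain ⟨γ, h1, h2, h3⟩ := h
  exact ⟨_, _, h1.isLipPath h2, h3⟩

/-- Together with `exists_isLipPath_of_qhDist_lt`, this makes `k` an infimum over `1`-Lipschitz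
paths, which can be cut, reversed and concatenated without recomputing arc length parametrizations.
The arc length up to parameter `s` is a `1`-Lipschitz function of `s`, so passing to arc length does
not increase the integral. -/
theorem IsLipPath.qhDist_le {Ω : Set X} {x y : X} {L : ℝ} {σ : ℝ → X}
    (h : IsLipPath Ω x y L σ) : qhDist Ω x y ≤ qhLen Ω L σ := by
  set γ : ℝ → X := fun t => σ (L * t) with hγ
  have hL := h.nonneg
  have hmaps : MapsTo (fun t : ℝ => L * t) (Icc 0 1) (Icc 0 L) := fun t ht =>
    ⟨mul_nonneg hL ht.1, mul_le_of_le_one_right hL ht.2⟩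
  have hlip : LipschitzOnWith L.toNNReal γ (Icc 0 1) := by
    refine LipschitzOnWith.of_dist_le_mul fun r hr s hs => ?_
    refine (h.lipschitzOnWith.dist_le_mul _ (hmaps hr) _ (hmaps hs)).trans ?_
    rw [NNReal.coe_one, one_mul, Real.coe_toNNReal L hL, Real.dist_eq, Real.dist_eq, ← mul_sub, abs_mul,
      abs_of_nonneg hL]
  have hp : IsPathIn Ω x y γ :=
    ⟨hlip.continuousOn, h.mapsTo.comp hmaps, by simp [hγ, h.source], by simp [hγ, h.target]⟩
  have hb : len γ 0 1 ≠ ∞ := by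
    refine ne_top_of_le_ne_top ?_ (eVariationOn_Icc_le_of_lipschitzOnWith hlip)
    finiteness
  refine (iInf₂_le_of_le γ hp (iInf_le_of_le hb le_rfl)).trans ?_
  have hloc := locallyBoundedVariationOn_of_len_ne_top hb
  have h0 : (0 : ℝ) ∈ Icc (0 : ℝ) 1 := by simp
  -- For `L = 0` the rescaling `s / L` below is unavailable, but the path has length `0`.
  rcases hL.eq_or_lt with rfl | hLpos
  · have : len γ 0 1 = 0 := by
      refine le_antisymm ((eVariationOn_Icc_le_of_lipschitzOnWith hlip).trans ?_) zero_le
      simp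
    simp [lineIntegral, this]
  set v : ℝ → ℝ := fun s => variationOnFromTo γ (Icc 0 1) 0 (s / L) with hv
  have hdiv : MapsTo (fun s : ℝ => s / L) (Icc 0 L) (Icc 0 1) := fun s hs =>
    ⟨div_nonneg hs.1 hL, (div_le_one hLpos).2 hs.2⟩
  have hvlip : LipschitzOnWith 1 v (Icc 0 L) := by
    have key : ∀ r ∈ Icc 0 L, ∀ s ∈ Icc 0 L, r ≤ s → dist (v r) (v s) ≤ s - r := by
      intro r hr s hs hrs
      have hrs' : r / L ≤ s / L := by gcongr
      have hsub := variationOnFromTo.sub_right hloc h0 (hdiv hs) (hdiv hr)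
      rw [dist_comm, Real.dist_eq, hsub, abs_of_nonneg (variationOnFromTo.nonneg_of_le _ _ hrs'),
        variationOnFromTo.eq_of_le _ _ hrs',
        inter_eq_right.2 (Icc_subset_Icc (hdiv hr).1 (hdiv hs).2)]
      have := eVariationOn_Icc_le_of_lipschitzOnWith
        (hlip.mono (Icc_subset_Icc (hdiv hr).1 (hdiv hs).2))
      refine (ENNReal.toReal_mono (by finiteness) this).trans_eq ?_
      rw [ENNReal.toReal_mul, ENNReal.toReal_ofReal (by linarith), ENNReal.coe_toReal,
        Real.coe_toNNReal L hL]
      field_simp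
    refine LipschitzOnWith.of_dist_le_mul fun r hr s hs => ?_
    rw [NNReal.coe_one, one_mul, Real.dist_eq r s]
    rcases le_total r s with hrs | hrs
    · rw [abs_sub_comm, abs_of_nonneg (sub_nonneg.2 hrs)]
      exact key r hr s hs hrs
    · rw [abs_of_nonneg (sub_nonneg.2 hrs), dist_comm]
      exact key s hs r hr hrs
  have himg : Icc 0 (len γ 0 1).toReal ⊆ v '' Icc 0 L := by
    rw [← image_variationOnFromTo hp.continuousOn hb]
    rintro _ ⟨t, ht, rfl⟩
    refine ⟨L * t, hmaps ht, ?_⟩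
    simp only [hv]
    rw [mul_div_cancel_left₀ _ hLpos.ne']
  refine (setLIntegral_le_of_lipschitzOnWith hvlip measurableSet_Icc himg _).trans_eq ?_
  refine setLIntegral_congr_fun measurableSet_Icc fun s hs => ?_
  simp only [hv]
  rw [naturalParameterization_variationOnFromTo hb (hdiv hs)]
  simp only [hγ, qhDensity]
  rw [mul_div_cancel₀ _ hLpos.ne']

/-! ### Distance to the boundary -/

section Boundary

variable {Ω : Set X} {x y : X}

theorem bdist_nonneg : 0 ≤ bdist Ω x := Metric.infDist_nonneg

theorem IsDomainWithBoundary.bdist_pos (hΩ : IsDomainWithBoundary Ω) (hx : x ∈ Ω) :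
    0 < bdist Ω x := by
  refine (isClosed_frontier.notMem_iff_infDist_pos hΩ.boundary_nonempty).1 fun h => ?_
  rw [hΩ.isOpen.frontier_eq] at h
  exact h.2 hx

theorem bdist_le_add_dist : bdist Ω x ≤ bdist Ω y + dist x y :=
  Metric.infDist_le_infDist_add_dist

theorem continuous_bdist : Continuous (bdist Ω) := Metric.continuous_infDist_pt _

theorem rDist_nonneg : 0 ≤ rDist Ω x y :=
  div_nonneg dist_nonneg (le_min bdist_nonneg bdist_nonneg)

theorem jDist_nonneg : 0 ≤ jDist Ω x y :=
  Real.log_nonneg (le_add_of_nonneg_right rDist_nonneg)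

end Boundary

theorem lipschitzOnWith_const_sub (L : ℝ) (S : Set ℝ) : LipschitzOnWith 1 (fun s => L - s) S :=
  LipschitzOnWith.of_dist_le_mul fun r _ s _ => by
    rw [dist_sub_left, NNReal.coe_one, one_mul]

theorem lipschitzOnWith_add_const (L : ℝ) (S : Set ℝ) : LipschitzOnWith 1 (fun s => s + L) S :=
  LipschitzOnWith.of_dist_le_mul fun r _ s _ => by simp

/-! ### Operations on Lipschitz paths, the triangle inequality and a lower bound for `k` -/

section LipPath

variable {Ω : Set X} {x y z : X} {L M : ℝ} {σ τ : ℝ → X}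

theorem IsLipPath.symm (h : IsLipPath Ω x y L σ) : IsLipPath Ω y x L (fun s => σ (L - s)) where
  nonneg := h.nonneg
  dist_le r s hr hrs hs := by
    rw [dist_comm]
    convert h.dist_le (L - s) (L - r) (by linarith) (by linarith) (by linarith) using 1
    ring
  mapsTo s hs := h.mapsTo ⟨by linarith [hs.2], by linarith [hs.1]⟩
  source := by simp [h.target]
  target := by simp [h.source]

theorem qhLen_symm_le : qhLen Ω L (fun s => σ (L - s)) ≤ qhLen Ω L σ := by
  have hv : LipschitzOnWith 1 (fun s => L - s) (Icc 0 L) :=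
    lipschitzOnWith_const_sub _ _
  refine (setLIntegral_le_of_lipschitzOnWith hv measurableSet_Icc (T := Icc 0 L) ?_ _).trans_eq ?_
  · intro t ht
    exact ⟨L - t, ⟨by linarith [ht.2], by linarith [ht.1]⟩, by simp⟩
  · simp [qhLen]

theorem qhDist_comm_le : qhDist Ω y x ≤ qhDist Ω x y := by
  refine le_of_forall_gt fun a ha => ?_
  obtain ⟨L, σ, h, hlt⟩ := exists_isLipPath_of_qhDist_lt ha
  exact (h.symm.qhDist_le.trans qhLen_symm_le).trans_lt hlt

theorem qhDist_comm (Ω : Set X) (x y : X) : qhDist Ω x y = qhDist Ω y x :=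
  le_antisymm qhDist_comm_le qhDist_comm_le

/-- Concatenation of `σ` on `[0, L]` with `τ`. -/
def concat {Y : Type*} (L : ℝ) (σ τ : ℝ → Y) (s : ℝ) : Y := if s ≤ L then σ s else τ (s - L)

theorem concat_of_le {Y : Type*} {σ τ : ℝ → Y} {L s : ℝ} (h : s ≤ L) : concat L σ τ s = σ s := if_pos h

theorem IsLipPath.concat_of_ge (hσ : IsLipPath Ω x y L σ) (hτ : IsLipPath Ω y z M τ) {s : ℝ}
    (h : L ≤ s) : concat L σ τ s = τ (s - L) := by
  rcases h.eq_or_lt with rfl | h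
  · rw [concat_of_le le_rfl, sub_self, hσ.target, hτ.source]
  · exact if_neg h.not_ge

theorem IsLipPath.trans (hσ : IsLipPath Ω x y L σ) (hτ : IsLipPath Ω y z M τ) :
    IsLipPath Ω x z (L + M) (concat L σ τ) where
  nonneg := add_nonneg hσ.nonneg hτ.nonneg
  dist_le r s hr hrs hs := by
    rcases le_total s L with h | h
    · rw [concat_of_le h, concat_of_le (hrs.trans h)]
      exact hσ.dist_le r s hr hrs h
    rcases le_total L r with h' | h'
    · rw [hσ.concat_of_ge hτ h, hσ.concat_of_ge hτ h']
      convert hτ.dist_le (r - L) (s - L) (by linarith) (by linarith) (by linarith) using 1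
      ring
    · rw [hσ.concat_of_ge hτ h, concat_of_le h']
      have h1 := hσ.dist_le r L hr h' le_rfl
      have h2 := hτ.dist_le 0 (s - L) le_rfl (by linarith) (by linarith)
      rw [hσ.target] at h1
      rw [hτ.source] at h2
      linarith [dist_triangle (σ r) y (τ (s - L))]
  mapsTo s hs := by
    rcases le_total s L with h | h
    · rw [concat_of_le h]
      exact hσ.mapsTo ⟨hs.1, h⟩
    · rw [hσ.concat_of_ge hτ h]
      exact hτ.mapsTo ⟨by linarith, by linarith [hs.2]⟩
  source := by rw [concat_of_le hσ.nonneg, hσ.source]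
  target := by
    rw [hσ.concat_of_ge hτ (by linarith [hτ.nonneg]), add_sub_cancel_left, hτ.target]

theorem IsLipPath.qhLen_concat_le (hσ : IsLipPath Ω x y L σ) (hτ : IsLipPath Ω y z M τ) :
    qhLen Ω (L + M) (concat L σ τ) ≤ qhLen Ω L σ + qhLen Ω M τ := by
  have hsub : Icc 0 (L + M) ⊆ Icc 0 L ∪ Icc L (L + M) := fun s hs => by
    rcases le_total s L with h | h
    · exact Or.inl ⟨hs.1, h⟩
    · exact Or.inr ⟨h, hs.2⟩
  refine (lintegral_mono_set hsub).trans ((lintegral_union_le _ _ _).trans (add_le_add ?_ ?_))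
  · refine le_of_eq (setLIntegral_congr_fun measurableSet_Icc fun s hs => ?_)
    simp only [concat_of_le hs.2]
  · have hv : LipschitzOnWith 1 (fun s => s + L) (Icc 0 M) :=
      lipschitzOnWith_add_const _ _
    refine (setLIntegral_le_of_lipschitzOnWith hv measurableSet_Icc (T := Icc L (L + M)) ?_
      _).trans_eq (setLIntegral_congr_fun measurableSet_Icc fun s hs => ?_)
    · intro t ht
      exact ⟨t - L, ⟨by linarith [ht.1], by linarith [ht.2]⟩, by simp⟩
    · rw [hσ.concat_of_ge hτ (by linarith [hs.1]), add_sub_cancel_right]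

theorem qhDist_triangle (Ω : Set X) (x y z : X) :
    qhDist Ω x z ≤ qhDist Ω x y + qhDist Ω y z := by
  refine ENNReal.le_of_forall_pos_le_add fun ε hε hlt => ?_
  have h1 : qhDist Ω x y ≠ ∞ := (ENNReal.add_lt_top.1 hlt).1.ne
  have h2 : qhDist Ω y z ≠ ∞ := (ENNReal.add_lt_top.1 hlt).2.ne
  have hε' : ((ε / 2 : NNReal) : ℝ≥0∞) ≠ 0 := by
    simpa using hε.ne'
  obtain ⟨L, σ, hσ, hσ'⟩ := exists_isLipPath_of_qhDist_lt (ENNReal.lt_add_right h1 hε')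
  obtain ⟨M, τ, hτ, hτ'⟩ := exists_isLipPath_of_qhDist_lt (ENNReal.lt_add_right h2 hε')
  refine ((hσ.trans hτ).qhDist_le.trans (hσ.qhLen_concat_le hτ)).trans ?_
  refine (add_le_add hσ'.le hτ'.le).trans_eq ?_
  have : (ε : ℝ≥0∞) = ((ε / 2 : NNReal) : ℝ≥0∞) + ((ε / 2 : NNReal) : ℝ≥0∞) := by
    rw [← ENNReal.coe_add, add_halves]
  rw [this]
  ring

theorem IsLipPath.subpath (h : IsLipPath Ω x y L σ) {a b : ℝ} (ha : 0 ≤ a) (hab : a ≤ b)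
    (hb : b ≤ L) : IsLipPath Ω (σ a) (σ b) (b - a) (fun s => σ (a + s)) where
  nonneg := sub_nonneg.2 hab
  dist_le r s hr hrs hs := by
    convert h.dist_le (a + r) (a + s) (by linarith) (by linarith) (by linarith) using 1
    ring
  mapsTo s hs := h.mapsTo ⟨by linarith [hs.1], by linarith [hs.2]⟩
  source := by simp
  target := by simp

theorem IsLipPath.qhDist_le_setLIntegral (h : IsLipPath Ω x y L σ) {a b : ℝ} (ha : 0 ≤ a)
    (hab : a ≤ b) (hb : b ≤ L) :
    qhDist Ω (σ a) (σ b) ≤ ∫⁻ s in Icc a b, qhDensity Ω (σ s) := by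
  refine (h.subpath ha hab hb).qhDist_le.trans ?_
  have hv : LipschitzOnWith 1 (fun s => s - a) (Icc a b) := by
    simpa [sub_eq_add_neg] using lipschitzOnWith_add_const (-a) _
  refine (setLIntegral_le_of_lipschitzOnWith hv measurableSet_Icc (T := Icc 0 (b - a)) ?_
    _).trans_eq ?_
  · intro t ht
    exact ⟨a + t, ⟨by linarith [ht.1], by linarith [ht.2]⟩, by simp⟩
  · simp

theorem setLIntegral_Icc_inv_add {d L : ℝ} (hd : 0 < d) (hL : 0 ≤ L) :
    ∫⁻ s in Icc 0 L, (ENNReal.ofReal (d + s))⁻¹ = ENNReal.ofReal (Real.log (1 + L / d)) := by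
  have h1 : ∫⁻ s in Icc 0 L, (ENNReal.ofReal (d + s))⁻¹
      = ∫⁻ s in Icc 0 L, ENNReal.ofReal ((d + s)⁻¹) := by
    refine setLIntegral_congr_fun measurableSet_Icc fun s hs => ?_
    rw [ENNReal.ofReal_inv_of_pos (by linarith [hs.1])]
  have hc : ContinuousOn (fun s => (d + s)⁻¹) (Icc 0 L) :=
    ContinuousOn.inv₀ (by fun_prop) fun s hs => by linarith [hs.1]
  rw [h1, ← ofReal_integral_eq_lintegral_ofReal (hc.integrableOn_Icc)]
  · congr 1
    rw [integral_Icc_eq_integral_Ioc, ← intervalIntegral.integral_of_le hL]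
    have := intervalIntegral.integral_comp_add_left (a := 0) (b := L) (fun s : ℝ => s⁻¹) d
    rw [this, integral_inv_of_pos (by linarith) (by linarith)]
    congr 1
    field_simp
    ring
  · refine (ae_restrict_iff' measurableSet_Icc).2 (Eventually.of_forall fun s hs => ?_)
    exact inv_nonneg.2 (by linarith [hs.1])

theorem IsLipPath.dist_le_length (h : IsLipPath Ω x y L σ) : dist x y ≤ L := by
  simpa [h.source, h.target] using h.dist_le 0 L le_rfl h.nonneg le_rfl

theorem IsLipPath.dist_source_le (h : IsLipPath Ω x y L σ) {s : ℝ} (hs : s ∈ Icc 0 L) :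
    dist (σ s) x ≤ s := by
  have := h.dist_le 0 s le_rfl hs.1 hs.2
  rwa [h.source, sub_zero, dist_comm] at this

theorem IsLipPath.dist_target_le (h : IsLipPath Ω x y L σ) {s : ℝ} (hs : s ∈ Icc 0 L) :
    dist (σ s) y ≤ L - s := by
  have := h.dist_le s L hs.1 hs.2 le_rfl
  rwa [h.target] at this

/-- At parameter `s` of a `1`-Lipschitz path from `x`, the boundary distance is at most `d(x) + s`,
so the quasihyperbolic length is at least `∫ ds / (d(x) + s)`. -/
theorem IsDomainWithBoundary.log_le_qhDist (hΩ : IsDomainWithBoundary Ω) (hx : x ∈ Ω) :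
    ENNReal.ofReal (Real.log (1 + dist x y / bdist Ω x)) ≤ qhDist Ω x y := by
  refine le_of_forall_gt fun a ha => ?_
  obtain ⟨L, σ, h, hlt⟩ := exists_isLipPath_of_qhDist_lt ha
  refine lt_of_le_of_lt ?_ hlt
  have hd := hΩ.bdist_pos hx
  have hle := h.dist_le_length
  calc ENNReal.ofReal (Real.log (1 + dist x y / bdist Ω x))
      ≤ ENNReal.ofReal (Real.log (1 + L / bdist Ω x)) := by
        refine ENNReal.ofReal_le_ofReal (Real.log_le_log ?_ ?_)
        · have : 0 ≤ dist x y / bdist Ω x := by positivity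
          linarith
        · gcongr
    _ = ∫⁻ s in Icc 0 L, (ENNReal.ofReal (bdist Ω x + s))⁻¹ :=
        (setLIntegral_Icc_inv_add hd h.nonneg).symm
    _ ≤ qhLen Ω L σ := by
        refine setLIntegral_mono' measurableSet_Icc fun s hs => ?_
        rw [qhDensity]
        gcongr
        exact bdist_le_add_dist.trans (by linarith [h.dist_source_le hs])

end LipPath

/-! ### Nearby points in a quasiconvex domain -/

section Local

variable {Ω : Set X} {x y : X}

/-- A rectifiable path of length at most `ℓ ≤ d(x) / 2` starting at `x` has quasihyperbolic
length at most `2 ℓ / d(x)`. -/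
theorem IsPathIn.qhDist_le {γ : ℝ → X} (h : IsPathIn Ω x y γ) {ℓ : ℝ} (hx : 0 < bdist Ω x)
    (hℓ : 0 ≤ ℓ) (hlen : len γ 0 1 ≤ ENNReal.ofReal ℓ) (hle : ℓ ≤ bdist Ω x / 2) :
    qhDist Ω x y ≤ ENNReal.ofReal (2 * ℓ / bdist Ω x) := by
  have hb : len γ 0 1 ≠ ∞ := ne_top_of_le_ne_top (by finiteness) hlen
  have hp := h.isLipPath hb
  have hL : (len γ 0 1).toReal ≤ ℓ := ENNReal.toReal_le_of_le_ofReal hℓ hlen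
  refine hp.qhDist_le.trans ?_
  calc qhLen Ω (len γ 0 1).toReal (naturalParameterization γ (Icc 0 1) 0)
      ≤ ∫⁻ s in Icc 0 (len γ 0 1).toReal, ENNReal.ofReal (2 / bdist Ω x) := by
        refine setLIntegral_mono' measurableSet_Icc fun s hs => ?_
        have h1 := hp.dist_source_le hs
        have h2 := bdist_le_add_dist (Ω := Ω) (x := x)
          (y := naturalParameterization γ (Icc 0 1) 0 s)
        rw [dist_comm] at h2
        have h3 : bdist Ω x / 2 ≤ bdist Ω (naturalParameterization γ (Icc 0 1) 0 s) := by
          linarith [hs.2]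
        rw [qhDensity, ← ENNReal.ofReal_inv_of_pos (by linarith)]
        refine ENNReal.ofReal_le_ofReal ?_
        rw [← inv_div]
        exact inv_anti₀ (by linarith) h3
    _ = ENNReal.ofReal (2 / bdist Ω x) * ENNReal.ofReal (len γ 0 1).toReal := by
        rw [setLIntegral_const, Real.volume_Icc, sub_zero]
    _ ≤ ENNReal.ofReal (2 * ℓ / bdist Ω x) := by
        rw [← ENNReal.ofReal_mul (by positivity)]
        refine ENNReal.ofReal_le_ofReal ?_
        rw [div_mul_eq_mul_div]
        gcongr

/-- The smallness of `d(x,y)` puts `y` in the quasiconvexity ball and keeps the joining path shorter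
than `d(x)/2`, so that the density is at most `2 / d(x)` along it. -/
theorem IsQuasiconvexDomain.qhDist_le {lam c : ℝ} (h : IsQuasiconvexDomain lam c Ω)
    (hlam : 0 < lam) (hlam' : lam ≤ 1) (hc : 1 ≤ c) (hx : x ∈ Ω)
    (hd : 2 * c * dist x y < lam * bdist Ω x) :
    qhDist Ω x y ≤ ENNReal.ofReal (2 * (c * dist x y) / bdist Ω x) := by
  have hpos := h.bdist_pos hx
  have hn : 0 ≤ dist x y := dist_nonneg
  have h1 : dist x y ≤ 2 * c * dist x y := le_mul_of_one_le_left hn (by linarith)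
  have h2 : lam * bdist Ω x ≤ bdist Ω x := mul_le_of_le_one_left hpos.le hlam'
  obtain ⟨γ, hγ, hlen⟩ := h.exists_path x hx x (Metric.mem_ball_self (by positivity)) y
    (by rw [Metric.mem_ball, dist_comm]; linarith)
  exact hγ.qhDist_le hpos (by positivity) hlen (by linarith)

end Local

/-! ### Uniform implies QH uniform, and removal of the additive constant -/

section Implications

variable {Ω : Set X} {x y : X}

theorem coe_ennreal_le_coe_iff {a : ℝ≥0∞} {b : ℝ} (hb : 0 ≤ b) :
    (a : EReal) ≤ (b : EReal) ↔ a ≤ ENNReal.ofReal b := by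
  rw [← EReal.coe_ennreal_le_coe_ennreal_iff, EReal.coe_ennreal_ofReal, max_eq_left hb]

theorem isQHUniform_iff {c : ℝ} (hc : 0 ≤ c) : IsQHUniform c Ω ↔
    ∀ x ∈ Ω, ∀ y ∈ Ω, qhDist Ω x y ≤ ENNReal.ofReal (c * jDist Ω x y) :=
  forall₂_congr fun _ _ => forall₂_congr fun _ _ =>
    coe_ennreal_le_coe_iff (mul_nonneg hc jDist_nonneg)

theorem log_one_add_mul_le {c r : ℝ} (hc : 1 ≤ c) (hr : 0 ≤ r) :
    Real.log (1 + c * r) ≤ c * Real.log (1 + r) := by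
  rw [← Real.log_rpow (by linarith)]
  exact Real.log_le_log (by nlinarith) (one_add_mul_self_le_rpow_one_add (by linarith) hc)

theorem add_le_of_two_bounds {d s c D : ℝ} (hd : 0 < d) (hc : 1 ≤ c) (h1 : d - s ≤ D)
    (h2 : s ≤ c * D) : (d + s) ≤ 3 * c * D := by
  by_cases h : s ≤ d / 2
  · nlinarith
  · nlinarith

/-- A uniform domain is quasihyperbolically uniform. -/
theorem IsUniform.isQHUniform {c : ℝ} (hc : 1 ≤ c) (hΩ : IsDomainWithBoundary Ω)
    (h : IsUniform c Ω) : IsQHUniform (6 * c ^ 2) Ω := by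
  rw [isQHUniform_iff (by positivity)]
  intro x hx y hy
  obtain ⟨γ, hγ⟩ := h x hx y hy
  have hb : len γ 0 1 ≠ ∞ := ne_top_of_le_ne_top (by finiteness) hγ.len_le
  have hp := hγ.toIsPathIn.isLipPath hb
  have hcd : 0 ≤ c * dist x y := by positivity
  have hℓ : (len γ 0 1).toReal ≤ c * dist x y := ENNReal.toReal_le_of_le_ofReal hcd hγ.len_le
  have hdx := hΩ.bdist_pos hx
  have hdy := hΩ.bdist_pos hy
  set ℓ := (len γ 0 1).toReal with hℓdef
  set σ := naturalParameterization γ (Icc 0 1) 0 with hσ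
  -- Summing the bounds seen from `x` and from `y` avoids splitting the curve according to which
  -- half realizes the minimum.
  have hpt : ∀ s ∈ Icc 0 ℓ, qhDensity Ω (σ s) ≤ ENNReal.ofReal (3 * c) *
      ((ENNReal.ofReal (bdist Ω x + s))⁻¹ + (ENNReal.ofReal (bdist Ω y + (ℓ - s)))⁻¹) := by
    intro s hs
    obtain ⟨t, ht, ets, eσ⟩ := exists_eq_naturalParameterization hγ.continuousOn hb hs
    have hD := hΩ.bdist_pos (hp.mapsTo hs)
    have key : ∀ d r : ℝ, 0 < d → 0 ≤ r → d - r ≤ bdist Ω (σ s) → r ≤ c * bdist Ω (σ s) →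
        qhDensity Ω (σ s) ≤ ENNReal.ofReal (3 * c) * (ENNReal.ofReal (d + r))⁻¹ := by
      intro d r hd hr h1 h2
      have h3 := add_le_of_two_bounds hd hc h1 h2
      rw [qhDensity, ← ENNReal.ofReal_inv_of_pos hD, ← ENNReal.ofReal_inv_of_pos (by linarith),
        ← ENNReal.ofReal_mul (by linarith)]
      refine ENNReal.ofReal_le_ofReal ?_
      rw [← div_eq_mul_inv, inv_eq_one_div, div_le_div_iff₀ hD (by linarith)]
      linarith
    have hadd := len_add (γ := γ) ht.1 ht.2
    have hne1 : len γ 0 t ≠ ∞ := ne_top_of_le_ne_top hb (hadd ▸ le_self_add)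
    have hne2 : len γ t 1 ≠ ∞ := ne_top_of_le_ne_top hb (hadd ▸ le_add_self)
    have hsum : s + (len γ t 1).toReal = ℓ := by
      rw [← ets, ← ENNReal.toReal_add hne1 hne2, hadd]
    have hmin := hγ.min_len_le t ht
    rw [← eσ] at hmin
    have hcD : 0 ≤ c * bdist Ω (σ s) := by positivity
    rw [mul_add]
    rcases min_le_iff.1 hmin with h1 | h1
    · refine le_add_of_le_left (key _ _ hdx hs.1 ?_ ?_)
      · have := bdist_le_add_dist (Ω := Ω) (x := x) (y := σ s)
        rw [dist_comm] at this
        linarith [hp.dist_source_le hs]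
      · exact ets.symm.trans_le (ENNReal.toReal_le_of_le_ofReal hcD h1)
    · refine le_add_of_le_right (key _ _ hdy (by linarith [hs.2]) ?_ ?_)
      · have := bdist_le_add_dist (Ω := Ω) (x := y) (y := σ s)
        rw [dist_comm] at this
        linarith [hp.dist_target_le hs]
      · have := ENNReal.toReal_le_of_le_ofReal hcD h1
        linarith
  have hrefl : ∫⁻ s in Icc 0 ℓ, (ENNReal.ofReal (bdist Ω y + (ℓ - s)))⁻¹ ≤
      ∫⁻ s in Icc 0 ℓ, (ENNReal.ofReal (bdist Ω y + s))⁻¹ := by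
    have hv : LipschitzOnWith 1 (fun s => ℓ - s) (Icc 0 ℓ) :=
      lipschitzOnWith_const_sub _ _
    refine (setLIntegral_le_of_lipschitzOnWith hv measurableSet_Icc (T := Icc 0 ℓ) ?_ _).trans_eq ?_
    · intro t ht
      exact ⟨ℓ - t, ⟨by linarith [ht.2], by linarith [ht.1]⟩, by simp⟩
    · simp
  have hr := rDist_nonneg (Ω := Ω) (x := x) (y := y)
  have hlog : ∀ d, 0 < d → min (bdist Ω x) (bdist Ω y) ≤ d →
      Real.log (1 + ℓ / d) ≤ c * jDist Ω x y := by
    intro d hd hmin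
    refine le_trans (Real.log_le_log ?_ ?_) (log_one_add_mul_le hc hr)
    · have : 0 ≤ ℓ / d := div_nonneg hp.nonneg hd.le
      linarith
    · rw [rDist, ← mul_div_assoc]
      have : 0 < min (bdist Ω x) (bdist Ω y) := lt_min hdx hdy
      gcongr
  refine hp.qhDist_le.trans ?_
  calc qhLen Ω ℓ σ ≤ ∫⁻ s in Icc 0 ℓ, ENNReal.ofReal (3 * c) *
      ((ENNReal.ofReal (bdist Ω x + s))⁻¹ + (ENNReal.ofReal (bdist Ω y + (ℓ - s)))⁻¹) :=
        setLIntegral_mono' measurableSet_Icc hpt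
    _ = ENNReal.ofReal (3 * c) * ((∫⁻ s in Icc 0 ℓ, (ENNReal.ofReal (bdist Ω x + s))⁻¹)
        + ∫⁻ s in Icc 0 ℓ, (ENNReal.ofReal (bdist Ω y + (ℓ - s)))⁻¹) := by
        rw [lintegral_const_mul' _ _ (by finiteness), lintegral_add_left (by fun_prop)]
    _ ≤ ENNReal.ofReal (3 * c) * (ENNReal.ofReal (c * jDist Ω x y)
        + ENNReal.ofReal (c * jDist Ω x y)) := by
        gcongr
        · rw [setLIntegral_Icc_inv_add hdx hp.nonneg]
          exact ENNReal.ofReal_le_ofReal (hlog _ hdx (min_le_left _ _))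
        · refine hrefl.trans ?_
          rw [setLIntegral_Icc_inv_add hdy hp.nonneg]
          exact ENNReal.ofReal_le_ofReal (hlog _ hdy (min_le_right _ _))
    _ = ENNReal.ofReal (6 * c ^ 2 * jDist Ω x y) := by
        have := mul_nonneg (zero_le_one.trans hc) (jDist_nonneg (Ω := Ω) (x := x) (y := y))
        rw [← ENNReal.ofReal_add this this, ← ENNReal.ofReal_mul (by positivity)]
        congr 1
        ring

theorem IsQHUniform.qhBound {c : ℝ} (h : IsQHUniform c Ω) : QHBound c 0 Ω := by
  intro x hx y hy
  rw [add_zero]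
  exact h x hx y hy

theorem div_one_add_le_log {r : ℝ} (hr : 0 ≤ r) : r / (1 + r) ≤ Real.log (1 + r) := by
  have h := Real.one_sub_inv_le_log_of_pos (x := 1 + r) (by linarith)
  have : r / (1 + r) = 1 - (1 + r)⁻¹ := by
    field_simp
    ring
  rwa [this]

/-- In a quasiconvex domain the additive constant in `k ≤ c j + c'` can be absorbed. -/
theorem QHBound.isQHUniform {lam c₀ c c' : ℝ} (hlam : 0 < lam) (hlam' : lam ≤ 1) (hc₀ : 1 ≤ c₀)
    (hΩ : IsQuasiconvexDomain lam c₀ Ω) (h : QHBound c c' Ω) :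
    IsQHUniform (max c 0 + max c' 0 / Real.log (1 + lam / (2 * c₀)) + 4 * c₀) Ω := by
  have ha : 0 < lam / (2 * c₀) := by positivity
  have hlog : 0 < Real.log (1 + lam / (2 * c₀)) := Real.log_pos (by linarith)
  rw [isQHUniform_iff (by positivity)]
  intro x hx y hy
  have hj := jDist_nonneg (Ω := Ω) (x := x) (y := y)
  have hdx := hΩ.bdist_pos hx
  have hdy := hΩ.bdist_pos hy
  have hr := rDist_nonneg (Ω := Ω) (x := x) (y := y)
  have hm : 0 < min (bdist Ω x) (bdist Ω y) := lt_min hdx hdy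
  have hdist : dist x y = rDist Ω x y * min (bdist Ω x) (bdist Ω y) := by
    rw [rDist, div_mul_cancel₀ _ hm.ne']
  -- Below this threshold quasiconvexity applies and `r ≤ 1`, whence `r ≤ (1 + r) log (1 + r) ≤ 2j`
  -- and `k ≤ 2c₀ r ≤ 4c₀ j`. Above it, `j ≥ log (1 + lam/(2c₀))`, which absorbs `c'`.
  by_cases hcase : rDist Ω x y < lam / (2 * c₀)
  · have h1 : dist x y ≤ rDist Ω x y * bdist Ω x := by
      rw [hdist]
      gcongr
      exact min_le_left _ _
    have h2 : 2 * c₀ * dist x y < lam * bdist Ω x := by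
      rw [lt_div_iff₀ (by positivity)] at hcase
      calc 2 * c₀ * dist x y ≤ 2 * c₀ * (rDist Ω x y * bdist Ω x) := by gcongr
        _ = (rDist Ω x y * (2 * c₀)) * bdist Ω x := by ring
        _ < _ := by gcongr
    refine (hΩ.qhDist_le hlam hlam' hc₀ hx h2).trans (ENNReal.ofReal_le_ofReal ?_)
    have h3 : 2 * (c₀ * dist x y) / bdist Ω x ≤ 2 * c₀ * rDist Ω x y := by
      rw [div_le_iff₀ hdx]
      calc 2 * (c₀ * dist x y) ≤ 2 * (c₀ * (rDist Ω x y * bdist Ω x)) := by gcongr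
        _ = _ := by ring
    have h4 : rDist Ω x y ≤ 2 * jDist Ω x y := by
      have hle1 : lam / (2 * c₀) ≤ 1 := by
        rw [div_le_one (by positivity)]
        linarith
      have := div_one_add_le_log hr
      rw [div_le_iff₀ (by linarith)] at this
      change rDist Ω x y ≤ 2 * Real.log (1 + rDist Ω x y)
      nlinarith [show 0 ≤ Real.log (1 + rDist Ω x y) from hj]
    have h5 : 0 ≤ max c 0 + max c' 0 / Real.log (1 + lam / (2 * c₀)) := by positivity
    nlinarith [mul_nonneg h5 hj]
  · have h1 : Real.log (1 + lam / (2 * c₀)) ≤ jDist Ω x y :=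
      Real.log_le_log (by linarith) (by linarith [not_lt.1 hcase])
    have h2 : c * jDist Ω x y + c' ≤
        (max c 0 + max c' 0 / Real.log (1 + lam / (2 * c₀)) + 4 * c₀) * jDist Ω x y := by
      have e1 : c * jDist Ω x y ≤ max c 0 * jDist Ω x y := by
        gcongr
        exact le_max_left _ _
      have e2 : c' ≤ max c' 0 / Real.log (1 + lam / (2 * c₀)) * jDist Ω x y := by
        rw [div_mul_eq_mul_div, le_div_iff₀ hlog]
        calc c' * Real.log (1 + lam / (2 * c₀)) ≤ max c' 0 * Real.log (1 + lam / (2 * c₀)) := by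
              gcongr
              exact le_max_left _ _
          _ ≤ _ := by gcongr
      have e3 : 0 ≤ 4 * c₀ * jDist Ω x y := by positivity
      linarith
    refine (coe_ennreal_le_coe_iff (by positivity)).1 ((h x hx y hy).trans ?_)
    exact_mod_cast h2

end Implications

/-! ### Comparison of `k` with the metric, and existence of geodesics -/

section Metric

variable {Ω : Set X} {x y : X}

theorem IsDomainWithBoundary.dist_le_of_qhDist_le (hΩ : IsDomainWithBoundary Ω) (hx : x ∈ Ω)
    {r : ℝ} (hr : 0 ≤ r) (h : qhDist Ω x y ≤ ENNReal.ofReal r) :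
    dist x y ≤ (Real.exp r - 1) * bdist Ω x := by
  have hd := hΩ.bdist_pos hx
  have h1 := (ENNReal.ofReal_le_ofReal_iff hr).1 ((hΩ.log_le_qhDist hx).trans h)
  have h0 : 0 ≤ dist x y / bdist Ω x := by positivity
  rw [Real.log_le_iff_le_exp (by linarith)] at h1
  rw [← div_le_iff₀ hd]
  linarith

theorem IsDomainWithBoundary.bdist_le_of_qhDist_le (hΩ : IsDomainWithBoundary Ω) (hx : x ∈ Ω)
    {r : ℝ} (hr : 0 ≤ r) (h : qhDist Ω x y ≤ ENNReal.ofReal r) :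
    bdist Ω y ≤ Real.exp r * bdist Ω x := by
  have h1 := hΩ.dist_le_of_qhDist_le hx hr h
  have h2 := bdist_le_add_dist (Ω := Ω) (x := y) (y := x)
  rw [dist_comm] at h2
  linarith

theorem IsDomainWithBoundary.eq_of_qhDist_le_zero (hΩ : IsDomainWithBoundary Ω) (hx : x ∈ Ω)
    (h : qhDist Ω x y ≤ 0) : x = y := by
  have := hΩ.dist_le_of_qhDist_le hx le_rfl (h.trans zero_le)
  rw [Real.exp_zero, sub_self, zero_mul] at this
  exact dist_le_zero.1 this

theorem IsQuasiconvexDomain.tendsto_qhDist {lam c : ℝ} (h : IsQuasiconvexDomain lam c Ω)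
    (hlam : 0 < lam) (hlam' : lam ≤ 1) (hc : 1 ≤ c) (hx : x ∈ Ω) {ι : Type*} {l : Filter ι}
    {f : ι → X} (hf : Tendsto f l (𝓝 x)) : Tendsto (fun i => qhDist Ω x (f i)) l (𝓝 0) := by
  have hpos := h.bdist_pos hx
  have hdist : Tendsto (fun i => dist x (f i)) l (𝓝 0) := by
    simpa [dist_comm] using tendsto_iff_dist_tendsto_zero.1 hf
  have h1 : Tendsto (fun i => 2 * c * dist x (f i)) l (𝓝 0) := by
    simpa using hdist.const_mul (2 * c)
  have h2 : Tendsto (fun i => ENNReal.ofReal (2 * (c * dist x (f i)) / bdist Ω x)) l (𝓝 0) := by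
    have := (h1.div_const (bdist Ω x))
    rw [zero_div] at this
    simpa [mul_assoc] using ENNReal.tendsto_ofReal this
  refine tendsto_of_tendsto_of_tendsto_of_le_of_le' tendsto_const_nhds h2
    (Eventually.of_forall fun _ => zero_le) ?_
  filter_upwards [h1.eventually_lt_const (show 0 < lam * bdist Ω x by positivity)] with i hi
  exact h.qhDist_le hlam hlam' hc hx hi

/-- Quasiconvexity makes `k` continuous for the topology of `X` on `Ω`, so bounds on `k` pass to
limits of points. -/
theorem IsQuasiconvexDomain.qhDist_le_of_tendsto {lam c : ℝ} (h : IsQuasiconvexDomain lam c Ω)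
    (hlam : 0 < lam) (hlam' : lam ≤ 1) (hc : 1 ≤ c) (hx : x ∈ Ω) (hy : y ∈ Ω) {ι : Type*}
    {l : Filter ι} [l.NeBot] {f g : ι → X} (hf : Tendsto f l (𝓝 x)) (hg : Tendsto g l (𝓝 y))
    {C : ι → ℝ≥0∞} {C₀ : ℝ≥0∞} (hC : Tendsto C l (𝓝 C₀)) (hle : ∀ i, qhDist Ω (f i) (g i) ≤ C i) :
    qhDist Ω x y ≤ C₀ := by
  have h1 := h.tendsto_qhDist hlam hlam' hc hx hf
  have h2 := h.tendsto_qhDist hlam hlam' hc hy hg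
  have h3 := (h1.add hC).add h2
  rw [zero_add, add_zero] at h3
  refine ge_of_tendsto h3 (Eventually.of_forall fun i => ?_)
  calc qhDist Ω x y ≤ qhDist Ω x (f i) + qhDist Ω (f i) (g i) + qhDist Ω (g i) y :=
        (qhDist_triangle Ω x (g i) y).trans (add_le_add_left (qhDist_triangle _ _ _ _) _)
    _ ≤ qhDist Ω x (f i) + C i + qhDist Ω y (g i) := by
        rw [qhDist_comm Ω (g i) y]
        gcongr
        exact hle i

theorem isCompact_inter_le_bdist [ProperSpace X] (x : X) (R ε : ℝ) :
    IsCompact (closure Ω ∩ {z | ε ≤ bdist Ω z} ∩ Metric.closedBall x R) :=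
  (isCompact_closedBall x R).inter_left
    (isClosed_closure.inter (isClosed_le continuous_const continuous_bdist))

theorem mem_of_mem_closure_of_bdist_pos {z : X} (hz : z ∈ closure Ω) (h : 0 < bdist Ω z) :
    z ∈ Ω := by
  by_contra hn
  have : z ∈ frontier Ω := ⟨hz, fun hi => hn (interior_subset hi)⟩
  rw [bdist, Metric.infDist_zero_of_mem this] at h
  exact h.false

/-- Points on a Lipschitz path at prescribed proportions of its quasihyperbolic length. -/
theorem IsLipPath.exists_proportional {L : ℝ} {σ : ℝ → X} (hΩ : IsDomainWithBoundary Ω)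
    (h : IsLipPath Ω x y L σ) :
    ∃ g : ℝ → X, ∀ t ∈ Icc (0 : ℝ) 1, g t ∈ Ω ∧
      qhDist Ω x (g t) ≤ ENNReal.ofReal t * qhLen Ω L σ ∧
      qhDist Ω (g t) y ≤ ENNReal.ofReal (1 - t) * qhLen Ω L σ ∧
      ∀ s ∈ Icc (0 : ℝ) 1, qhDist Ω (g s) (g t) ≤ ENNReal.ofReal |s - t| * qhLen Ω L σ := by
  have hL := h.nonneg
  set ρ : ℝ → ℝ := fun s => (bdist Ω (σ s))⁻¹ with hρ
  have hpos : ∀ s ∈ Icc 0 L, 0 < bdist Ω (σ s) := fun s hs => hΩ.bdist_pos (h.mapsTo hs)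
  have hcont : ContinuousOn ρ (Icc 0 L) :=
    (continuous_bdist.comp_continuousOn h.lipschitzOnWith.continuousOn).inv₀
      fun s hs => (hpos s hs).ne'
  have hint : ∀ a b, 0 ≤ a → a ≤ b → b ≤ L → IntervalIntegrable ρ volume a b := by
    intro a b ha hab hb
    exact (hcont.mono (Icc_subset_Icc ha hb)).intervalIntegrable_of_Icc hab
  have hlin : ∀ a b, 0 ≤ a → a ≤ b → b ≤ L →
      ∫⁻ s in Icc a b, qhDensity Ω (σ s) = ENNReal.ofReal (∫ s in a..b, ρ s) := by
    intro a b ha hab hb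
    rw [intervalIntegral.integral_of_le hab, ← integral_Icc_eq_integral_Ioc,
      ofReal_integral_eq_lintegral_ofReal ((hcont.mono (Icc_subset_Icc ha hb)).integrableOn_Icc)]
    · refine setLIntegral_congr_fun measurableSet_Icc fun s hs => ?_
      rw [qhDensity, ENNReal.ofReal_inv_of_pos (hpos s ⟨ha.trans hs.1, hs.2.trans hb⟩)]
    · refine (ae_restrict_iff' measurableSet_Icc).2 (Eventually.of_forall fun s _ => ?_)
      exact inv_nonneg.2 bdist_nonneg
  set I : ℝ → ℝ := fun s => ∫ u in (0 : ℝ)..s, ρ u with hI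
  have hIcont : ContinuousOn I (Icc 0 L) := by
    have := intervalIntegral.continuousOn_primitive_interval (μ := volume) (f := ρ) (a := 0)
      (b := L) (by rw [uIcc_of_le hL]; exact hcont.integrableOn_Icc)
    rwa [uIcc_of_le hL] at this
  have hI0 : I 0 = 0 := intervalIntegral.integral_same
  have hsub : ∀ a b, 0 ≤ a → a ≤ b → b ≤ L → qhDist Ω (σ a) (σ b) ≤ ENNReal.ofReal (I b - I a) := by
    intro a b ha hab hb
    refine (h.qhDist_le_setLIntegral ha hab hb).trans_eq ?_
    rw [hlin a b ha hab hb]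
    congr 1
    exact (intervalIntegral.integral_interval_sub_left (hint 0 b le_rfl (ha.trans hab) hb)
      (hint 0 a le_rfl ha (hab.trans hb))).symm
  have hIL : 0 ≤ I L := intervalIntegral.integral_nonneg hL fun s _ => inv_nonneg.2 bdist_nonneg
  have hqh : qhLen Ω L σ = ENNReal.ofReal (I L) := hlin 0 L le_rfl hL le_rfl
  have hex : ∀ t ∈ Icc (0 : ℝ) 1, ∃ a ∈ Icc 0 L, I a = t * I L := by
    intro t ht
    -- The primitive of the density is continuous, so it takes the value at every prescribed
    -- proportion.
    have := intermediate_value_Icc hL hIcont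
    rw [hI0] at this
    exact this ⟨mul_nonneg ht.1 hIL, mul_le_of_le_one_left hIL ht.2⟩
  choose! p hp hpI using hex
  refine ⟨fun t => σ (p t), fun t ht => ⟨h.mapsTo (hp t ht), ?_, ?_, fun s hs => ?_⟩⟩
  · have := hsub 0 (p t) le_rfl (hp t ht).1 (hp t ht).2
    rwa [h.source, hI0, hpI t ht, sub_zero, ENNReal.ofReal_mul ht.1, ← hqh] at this
  · have := hsub (p t) L (hp t ht).1 (hp t ht).2 le_rfl
    rwa [h.target, hpI t ht, ← one_sub_mul, ENNReal.ofReal_mul (by linarith [ht.2]), ← hqh] at this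
  · rw [hqh, ← ENNReal.ofReal_mul (abs_nonneg _)]
    have key : ∀ s ∈ Icc (0 : ℝ) 1, ∀ t ∈ Icc (0 : ℝ) 1, p s ≤ p t →
        qhDist Ω (σ (p s)) (σ (p t)) ≤ ENNReal.ofReal (|s - t| * I L) := by
      intro s hs t ht hst
      refine (hsub _ _ (hp s hs).1 hst (hp t ht).2).trans (ENNReal.ofReal_le_ofReal ?_)
      rw [hpI s hs, hpI t ht, ← sub_mul, abs_sub_comm]
      gcongr
      exact le_abs_self _
    rcases le_total (p s) (p t) with hst | hst
    · exact key s hs t ht hst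
    · rw [qhDist_comm, abs_sub_comm]
      exact key t ht s hs hst

/-- Any two points at finite quasihyperbolic distance in a quasiconvex domain of a proper space
are joined by a quasihyperbolic geodesic. -/
theorem IsQuasiconvexDomain.exists_isQHGeodesic [ProperSpace X] {lam c : ℝ}
    (h : IsQuasiconvexDomain lam c Ω) (hlam : 0 < lam) (hlam' : lam ≤ 1) (hc : 1 ≤ c)
    (hx : x ∈ Ω) (hfin : qhDist Ω x y ≠ ∞) :
    ∃ γ : ℝ → X, IsQHGeodesic Ω x y γ := by
  have hΩ := h.toIsDomainWithBoundary
  set K := qhDist Ω x y with hK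
  have hε : ∀ n : ℕ, K < K + ((n : ℝ≥0∞) + 1)⁻¹ := fun n =>
    ENNReal.lt_add_right hfin (by simp)
  have hy : y ∈ Ω := by
    obtain ⟨L, σ, hσ, -⟩ := exists_isLipPath_of_qhDist_lt (hε 0)
    rw [← hσ.target]
    exact hσ.mapsTo (right_mem_Icc.2 hσ.nonneg)
  have happ : ∀ n : ℕ, ∃ g : ℝ → X, ∀ t ∈ Icc (0 : ℝ) 1, g t ∈ Ω ∧
      qhDist Ω x (g t) ≤ ENNReal.ofReal t * (K + ((n : ℝ≥0∞) + 1)⁻¹) ∧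
      qhDist Ω (g t) y ≤ ENNReal.ofReal (1 - t) * (K + ((n : ℝ≥0∞) + 1)⁻¹) ∧
      ∀ s ∈ Icc (0 : ℝ) 1,
        qhDist Ω (g s) (g t) ≤ ENNReal.ofReal |s - t| * (K + ((n : ℝ≥0∞) + 1)⁻¹) := by
    intro n
    obtain ⟨L, σ, hσ, hlt⟩ := exists_isLipPath_of_qhDist_lt (hε n)
    obtain ⟨g, hg⟩ := hσ.exists_proportional hΩ
    refine ⟨g, fun t ht => ?_⟩
    obtain ⟨h1, h2, h3, h4⟩ := hg t ht
    exact ⟨h1, h2.trans (by gcongr), h3.trans (by gcongr),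
      fun s hs => (h4 s hs).trans (by gcongr)⟩
  choose g hg using happ
  -- A nonprincipal ultrafilter selects limits for all `t` at once, so neither a diagonal
  -- subsequence nor equicontinuity is needed.
  have hKlim : Tendsto (fun n : ℕ => K + ((n : ℝ≥0∞) + 1)⁻¹) (hyperfilter ℕ) (𝓝 K) := by
    have h1 : Tendsto (fun n : ℕ => ((n : ℝ≥0∞) + 1)⁻¹) atTop (𝓝 0) := by
      have := (tendsto_add_atTop_iff_nat 1).2 ENNReal.tendsto_inv_nat_nhds_zero
      simpa using this
    have h2 := h1.const_add K
    rw [add_zero] at h2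
    exact h2.mono_left (Nat.hyperfilter_le_atTop)
  have hmul : ∀ r : ℝ, Tendsto (fun n : ℕ => ENNReal.ofReal r * (K + ((n : ℝ≥0∞) + 1)⁻¹))
      (hyperfilter ℕ) (𝓝 (ENNReal.ofReal r * K)) := fun r =>
    ENNReal.Tendsto.const_mul hKlim (Or.inr (by finiteness))
  set B : ℝ := K.toReal + 1 with hB
  have hBpos : 0 ≤ B := by positivity
  have hKB : ∀ n : ℕ, ∀ r ≤ (1 : ℝ),
      ENNReal.ofReal r * (K + ((n : ℝ≥0∞) + 1)⁻¹) ≤ ENNReal.ofReal B := by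
    intro n r hr
    rw [hB, ENNReal.ofReal_add (by positivity) zero_le_one, ENNReal.ofReal_toReal hfin,
      ENNReal.ofReal_one]
    refine mul_le_of_le_one_of_le (by simpa using hr) ?_
    gcongr
    simp
  have hlim : ∀ t ∈ Icc (0 : ℝ) 1, ∃ z ∈ Ω,
      Tendsto (fun n => g n t) (hyperfilter ℕ) (𝓝 z) := by
    intro t ht
    -- All approximating points are within quasihyperbolic distance `B = K + 1` of `x`, hence in a
    -- bounded set where the boundary distance is at least `d(x) / exp B`; properness makes such a
    -- set compact.
    set ε : ℝ := bdist Ω x / Real.exp B with hεdef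
    have hεpos : 0 < ε := div_pos (hΩ.bdist_pos hx) (Real.exp_pos B)
    have hcpt := isCompact_inter_le_bdist (Ω := Ω) x ((Real.exp B - 1) * bdist Ω x) ε
    have hmem : ∀ n, g n t ∈ closure Ω ∩ {z | ε ≤ bdist Ω z} ∩
        Metric.closedBall x ((Real.exp B - 1) * bdist Ω x) := by
      intro n
      obtain ⟨h1, h2, -, -⟩ := hg n t ht
      have h3 := h2.trans (hKB n t ht.2)
      refine ⟨⟨subset_closure h1, ?_⟩, ?_⟩
      · rw [qhDist_comm] at h3
        have := hΩ.bdist_le_of_qhDist_le h1 hBpos h3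
        change ε ≤ _
        rw [hεdef, div_le_iff₀ (Real.exp_pos B)]
        linarith
      · rw [Metric.mem_closedBall, dist_comm]
        exact hΩ.dist_le_of_qhDist_le hx hBpos h3
    obtain ⟨z, hz, hle⟩ := hcpt.ultrafilter_le_nhds ((hyperfilter ℕ).map fun n => g n t)
      (le_principal_iff.2 (Ultrafilter.mem_map.2 (univ_mem' hmem)))
    exact ⟨z, mem_of_mem_closure_of_bdist_pos hz.1.1 (hεpos.trans_le hz.1.2), hle⟩
  have : Nonempty X := ⟨x⟩
  choose! γ hγΩ hγ using hlim
  have h0 : (0 : ℝ) ∈ Icc (0 : ℝ) 1 := by simp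
  have h1 : (1 : ℝ) ∈ Icc (0 : ℝ) 1 := by simp
  have hxγ : ∀ t ∈ Icc (0 : ℝ) 1, qhDist Ω x (γ t) ≤ ENNReal.ofReal t * K := fun t ht =>
    h.qhDist_le_of_tendsto hlam hlam' hc hx (hγΩ t ht) tendsto_const_nhds (hγ t ht) (hmul t)
      fun n => (hg n t ht).2.1
  have hγy : ∀ t ∈ Icc (0 : ℝ) 1, qhDist Ω (γ t) y ≤ ENNReal.ofReal (1 - t) * K := fun t ht =>
    h.qhDist_le_of_tendsto hlam hlam' hc (hγΩ t ht) hy (hγ t ht) tendsto_const_nhds (hmul _)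
      fun n => (hg n t ht).2.2.1
  have hγγ : ∀ s ∈ Icc (0 : ℝ) 1, ∀ t ∈ Icc (0 : ℝ) 1,
      qhDist Ω (γ s) (γ t) ≤ ENNReal.ofReal |s - t| * K := fun s hs t ht =>
    h.qhDist_le_of_tendsto hlam hlam' hc (hγΩ s hs) (hγΩ t ht) (hγ s hs) (hγ t ht) (hmul _)
      fun n => (hg n t ht).2.2.2 s hs
  have hγ0 : γ 0 = x := (hΩ.eq_of_qhDist_le_zero hx (by simpa using hxγ 0 h0)).symm
  have hγ1 : γ 1 = y := hΩ.eq_of_qhDist_le_zero (hγΩ 1 h1) (by simpa using hγy 1 h1)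
  -- The upper bounds on the three pieces add up to exactly `K`, so the triangle inequality forces
  -- equality on the middle one.
  have hge : ∀ s ∈ Icc (0 : ℝ) 1, ∀ t ∈ Icc (0 : ℝ) 1, s ≤ t →
      ENNReal.ofReal |s - t| * K ≤ qhDist Ω (γ s) (γ t) := by
    intro s hs t ht hst
    rw [abs_sub_comm, abs_of_nonneg (sub_nonneg.2 hst)]
    have hsum : ENNReal.ofReal (1 - (t - s)) * K + ENNReal.ofReal (t - s) * K = K := by
      rw [← add_mul, ← ENNReal.ofReal_add (by linarith [hs.1, ht.2]) (by linarith)]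
      simp
    have htri : K ≤ ENNReal.ofReal (1 - (t - s)) * K + qhDist Ω (γ s) (γ t) := by
      calc K ≤ qhDist Ω x (γ s) + qhDist Ω (γ s) (γ t) + qhDist Ω (γ t) y :=
            (qhDist_triangle Ω x (γ t) y).trans (add_le_add_left (qhDist_triangle _ _ _ _) _)
        _ ≤ ENNReal.ofReal s * K + qhDist Ω (γ s) (γ t) + ENNReal.ofReal (1 - t) * K := by
            gcongr
            · exact hxγ s hs
            · exact hγy t ht
        _ = ENNReal.ofReal (1 - (t - s)) * K + qhDist Ω (γ s) (γ t) := by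
            rw [show 1 - (t - s) = s + (1 - t) by ring,
              ENNReal.ofReal_add hs.1 (by linarith [ht.2])]
            ring
    nth_rw 1 [← hsum] at htri
    exact (ENNReal.add_le_add_iff_left (by finiteness)).1 htri
  refine ⟨γ, ⟨⟨?_, hγΩ, hγ0, hγ1⟩, hfin, fun s hs t ht => le_antisymm (hγγ s hs t ht) ?_⟩⟩
  · intro s hs
    rw [ContinuousWithinAt, tendsto_iff_dist_tendsto_zero]
    -- Continuity of the pointwise limit comes from the Lipschitz bound for `k` through `d(z,w) ≤
    -- (exp k(z,w) - 1) d(z)`.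
    have hbound : Tendsto (fun t => (Real.exp (|s - t| * K.toReal) - 1) * bdist Ω (γ s))
        (𝓝[Icc 0 1] s) (𝓝 0) := by
      have : Continuous fun t => (Real.exp (|s - t| * K.toReal) - 1) * bdist Ω (γ s) := by
        fun_prop
      have := this.tendsto s
      simp only [sub_self, abs_zero, zero_mul, Real.exp_zero] at this
      exact this.mono_left nhdsWithin_le_nhds
    refine squeeze_zero' (Eventually.of_forall fun _ => dist_nonneg) ?_ hbound
    filter_upwards [self_mem_nhdsWithin] with t ht
    rw [dist_comm]
    refine hΩ.dist_le_of_qhDist_le (hγΩ s hs) (by positivity) ((hγγ s hs t ht).trans_eq ?_)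
    rw [ENNReal.ofReal_mul (abs_nonneg _), ENNReal.ofReal_toReal hfin]
  · rcases le_total s t with hst | hst
    · exact hge s hs t ht hst
    · rw [abs_sub_comm, qhDist_comm Ω (γ s)]
      exact hge t ht s hs hst

end Metric

/-! ### Geodesics of QH uniform domains are uniform curves -/

section Geodesic

variable {Ω : Set X} {x y : X} {γ : ℝ → X}

theorem IsQHGeodesic.qhDist_eq_ofReal (h : IsQHGeodesic Ω x y γ) {s t : ℝ} (hs : s ∈ Icc (0 : ℝ) 1)
    (ht : t ∈ Icc (0 : ℝ) 1) :
    qhDist Ω (γ s) (γ t) = ENNReal.ofReal ((qhDist Ω x y).toReal * |s - t|) := by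
  rw [h.qhDist_eq s hs t ht, mul_comm (ENNReal.toReal _), ENNReal.ofReal_mul (abs_nonneg _),
    ENNReal.ofReal_toReal h.ne_top]

/-- Where `d ≤ M`, a quasihyperbolic geodesic is Lipschitz with constant `M` with respect to the
quasihyperbolic metric. -/
theorem IsQHGeodesic.dist_le (hΩ : IsDomainWithBoundary Ω) (h : IsQHGeodesic Ω x y γ)
    {u v M : ℝ} (hu : 0 ≤ u) (huv : u ≤ v) (hv : v ≤ 1)
    (hM : ∀ w ∈ Icc u v, bdist Ω (γ w) ≤ M) :
    dist (γ u) (γ v) ≤ (qhDist Ω x y).toReal * (v - u) * M := by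
  set K := (qhDist Ω x y).toReal with hK
  have hK0 : 0 ≤ K := ENNReal.toReal_nonneg
  set H := K * (v - u) with hH
  have hH0 : 0 ≤ H := mul_nonneg hK0 (sub_nonneg.2 huv)
  have hM0 : 0 ≤ M := bdist_nonneg.trans (hM u (left_mem_Icc.2 huv))
  -- Each of `n` equal pieces has quasihyperbolic length `H/n`, hence endpoints at distance at most
  -- `(exp (H/n) - 1) M`. The error is second order once `H ≤ n`, and disappears as `n → ∞`.
  have key : ∀ n : ℕ, 0 < n → H ≤ n → dist (γ u) (γ v) ≤ (H + H ^ 2 / n) * M := by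
    intro n hn hHn
    have hn' : (0 : ℝ) < n := by exact_mod_cast hn
    set p : ℕ → ℝ := fun i => u + i * ((v - u) / n) with hp
    have hstep : 0 ≤ (v - u) / n := div_nonneg (sub_nonneg.2 huv) hn'.le
    have hpn : p n = v := by
      simp only [hp]
      field_simp
      ring
    have hp0 : p 0 = u := by simp [hp]
    have hpm : Monotone p := fun i j hij => by
      simp only [hp]
      gcongr
    have hpmem : ∀ i ≤ n, p i ∈ Icc u v := fun i hi =>
      ⟨hp0 ▸ hpm (Nat.zero_le i), hpn ▸ hpm hi⟩
    have hpmem' : ∀ i ≤ n, p i ∈ Icc (0 : ℝ) 1 := fun i hi =>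
      ⟨hu.trans (hpmem i hi).1, (hpmem i hi).2.trans hv⟩
    have hone : ∀ i < n, dist (γ (p i)) (γ (p (i + 1))) ≤ (H / n + (H / n) ^ 2) * M := by
      intro i hi
      have habs : K * |p i - p (i + 1)| = H / n := by
        have : p i - p (i + 1) = -((v - u) / n) := by
          simp only [hp]
          push_cast
          ring
        rw [this, abs_neg, abs_of_nonneg hstep, hH, mul_div_assoc]
      have hq := h.qhDist_eq_ofReal (hpmem' i hi.le) (hpmem' (i + 1) hi)
      rw [← hK, habs] at hq
      have hHn0 : 0 ≤ H / n := div_nonneg hH0 hn'.le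
      have hHn1 : |H / n| ≤ 1 := by
        rw [abs_of_nonneg hHn0, div_le_one hn']
        exact hHn
      have h1 := hΩ.dist_le_of_qhDist_le (h.mapsTo (hpmem' i hi.le)) hHn0 hq.le
      have h2 := (abs_le.1 (Real.abs_exp_sub_one_sub_id_le hHn1)).2
      refine h1.trans (mul_le_mul (by linarith) (hM _ (hpmem i hi.le)) bdist_nonneg ?_)
      positivity
    have hsum := dist_le_range_sum_of_dist_le (f := fun i => γ (p i)) n fun {i} hi => hone i hi
    rw [hp0, hpn, Finset.sum_const, Finset.card_range, nsmul_eq_mul] at hsum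
    refine hsum.trans_eq ?_
    field_simp
  have hlim : Tendsto (fun n : ℕ => (H + H ^ 2 / n) * M) atTop (𝓝 ((H + 0) * M)) :=
    ((tendsto_const_div_atTop_nhds_zero_nat (H ^ 2)).const_add H).mul_const M
  rw [add_zero] at hlim
  refine ge_of_tendsto hlim ?_
  filter_upwards [eventually_gt_atTop 0, eventually_ge_atTop ⌈H⌉₊] with n hn hn'
  exact key n hn (Nat.ceil_le.1 hn')

theorem IsQHGeodesic.len_le (hΩ : IsDomainWithBoundary Ω) (h : IsQHGeodesic Ω x y γ)
    {s t M : ℝ} (hs : 0 ≤ s) (hst : s ≤ t) (ht : t ≤ 1)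
    (hM : ∀ w ∈ Icc s t, bdist Ω (γ w) ≤ M) :
    len γ s t ≤ ENNReal.ofReal ((qhDist Ω x y).toReal * (t - s) * M) := by
  set K := (qhDist Ω x y).toReal with hK
  have hK0 : 0 ≤ K := ENNReal.toReal_nonneg
  have hM0 : 0 ≤ M := bdist_nonneg.trans (hM s (left_mem_Icc.2 hst))
  have key : ∀ u ∈ Icc s t, ∀ v ∈ Icc s t, u ≤ v → dist (γ u) (γ v) ≤ K * M * (v - u) := by
    intro u hu v hv huv
    refine (h.dist_le hΩ (hs.trans hu.1) huv (hv.2.trans ht)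
      fun w hw => hM w ⟨hu.1.trans hw.1, hw.2.trans hv.2⟩).trans_eq ?_
    ring
  have hlip : LipschitzOnWith (K * M).toNNReal γ (Icc s t) := by
    refine LipschitzOnWith.of_dist_le_mul fun u hu v hv => ?_
    rw [Real.coe_toNNReal _ (mul_nonneg hK0 hM0), Real.dist_eq]
    rcases le_total u v with huv | huv
    · rw [abs_sub_comm, abs_of_nonneg (sub_nonneg.2 huv)]
      exact key u hu v hv huv
    · rw [abs_of_nonneg (sub_nonneg.2 huv), dist_comm]
      exact key v hv u hu huv
  refine (eVariationOn_Icc_le_of_lipschitzOnWith hlip).trans_eq ?_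
  rw [show K * (t - s) * M = K * M * (t - s) by ring, ENNReal.ofReal_mul (mul_nonneg hK0 hM0)]
  rfl

theorem IsQHGeodesic.continuousOn_bdist (h : IsQHGeodesic Ω x y γ) :
    ContinuousOn (fun t => bdist Ω (γ t)) (Icc 0 1) :=
  continuous_bdist.comp_continuousOn h.continuousOn

theorem IsQHGeodesic.len_ne_top (hΩ : IsDomainWithBoundary Ω) (h : IsQHGeodesic Ω x y γ) :
    len γ 0 1 ≠ ∞ := by
  obtain ⟨p, -, hmax⟩ := isCompact_Icc.exists_isMaxOn (nonempty_Icc.2 zero_le_one)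
    h.continuousOn_bdist
  exact ne_top_of_le_ne_top (by finiteness)
    (h.len_le hΩ le_rfl zero_le_one le_rfl (isMaxOn_iff.1 hmax))

theorem len_sub_len {s t : ℝ} (hb : len γ 0 1 ≠ ∞) (hs : 0 ≤ s) (hst : s ≤ t) (ht : t ≤ 1) :
    (len γ 0 t).toReal - (len γ 0 s).toReal = (len γ s t).toReal := by
  have h1 : len γ 0 s ≠ ∞ := ne_top_of_le_ne_top hb (len_mono le_rfl (hst.trans ht))
  have h2 : len γ s t ≠ ∞ := ne_top_of_le_ne_top hb (len_mono hs ht)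
  rw [← len_add hs hst, ENNReal.toReal_add h1 h2, add_sub_cancel_left]

theorem IsQHGeodesic.profile (hΩ : IsDomainWithBoundary Ω) (h : IsQHGeodesic Ω x y γ) {c : ℝ}
    (hc : 1 ≤ c) (hu : IsQHUniform c Ω) :
    GeodesicProfile (qhDist Ω x y).toReal c (dist x y) (fun t => bdist Ω (γ t))
      (fun t => (len γ 0 t).toReal) := by
  have hb := h.len_ne_top hΩ
  rw [isQHUniform_iff (by linarith)] at hu
  have hK0 : 0 ≤ (qhDist Ω x y).toReal := ENNReal.toReal_nonneg
  have hdist : ∀ s t, 0 ≤ s → s ≤ t → t ≤ 1 →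
      dist (γ s) (γ t) ≤ (len γ 0 t).toReal - (len γ 0 s).toReal := fun s t hs hst ht =>
    dist_le_len_toReal_sub hb hs hst ht
  refine ⟨hK0, hc, dist_nonneg, h.continuousOn_bdist,
    fun t ht => hΩ.bdist_pos (h.mapsTo ht), ?_, ?_, ?_, ?_⟩
  · intro s t hs hst ht
    exact ENNReal.toReal_mono (ne_top_of_le_ne_top hb (len_mono le_rfl ht)) (len_mono le_rfl hst)
  · intro s t M hs hst ht hM
    rw [len_sub_len hb hs hst ht]
    have hM0 : 0 ≤ M := bdist_nonneg.trans (hM s (left_mem_Icc.2 hst))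
    exact ENNReal.toReal_le_of_le_ofReal
      (mul_nonneg (mul_nonneg hK0 (sub_nonneg.2 hst)) hM0) (h.len_le hΩ hs hst ht hM)
  · intro s hs t ht
    refine hΩ.bdist_le_of_qhDist_le (h.mapsTo ht) (mul_nonneg hK0 (abs_nonneg _)) ?_
    rw [qhDist_comm, h.qhDist_eq_ofReal hs ht]
  · intro s t hs hst ht
    have hs' : s ∈ Icc (0 : ℝ) 1 := ⟨hs, hst.trans ht⟩
    have ht' : t ∈ Icc (0 : ℝ) 1 := ⟨hs.trans hst, ht⟩
    refine ⟨dist (γ s) (γ t), dist_nonneg, hdist s t hs hst ht, ?_, ?_⟩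
    · have h1 := hdist 0 s le_rfl hs (hst.trans ht)
      have h2 := hdist t 1 ht'.1 ht le_rfl
      -- The detour through the endpoints of the geodesic brings in `d(x,y)`, the only source of a
      -- length bound in terms of `δ`.
      have h3 := dist_triangle4 (γ s) (γ 0) (γ 1) (γ t)
      rw [dist_comm (γ s) (γ 0), dist_comm (γ 1) (γ t)] at h3
      have h4 : dist (γ 0) (γ 1) = dist x y := by rw [h.source, h.target]
      linarith
    · have h1 := hu _ (h.mapsTo hs') _ (h.mapsTo ht')
      rw [h.qhDist_eq_ofReal hs' ht', abs_sub_comm, abs_of_nonneg (sub_nonneg.2 hst)] at h1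
      exact (ENNReal.ofReal_le_ofReal_iff (mul_nonneg (by linarith) jDist_nonneg)).1 h1

/-- A constant for which quasihyperbolic geodesics of a quasihyperbolically `c`-uniform domain are
uniform curves. -/
def geodesicConst (c : ℝ) : ℝ :=
  2 * (8 * c ^ 2 + 1) * Real.exp (8 * c ^ 2 + 1) +
    (4 * (8 * c ^ 2 + 1) + Real.exp (c * Real.log (2 + 4 * (8 * c ^ 2 + 1))) *
      c * (1 + 4 * (8 * c ^ 2 + 1)))

theorem one_le_geodesicConst {c : ℝ} (hc : 1 ≤ c) : 1 ≤ geodesicConst c := by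
  have h1 : 0 ≤ 2 * (8 * c ^ 2 + 1) * Real.exp (8 * c ^ 2 + 1) := by positivity
  have h2 : 0 ≤ Real.exp (c * Real.log (2 + 4 * (8 * c ^ 2 + 1))) *
      c * (1 + 4 * (8 * c ^ 2 + 1)) := by positivity
  have h3 : 0 ≤ c ^ 2 := by positivity
  rw [geodesicConst]
  linarith

theorem IsQHGeodesic.isUniformCurve (hΩ : IsDomainWithBoundary Ω) (h : IsQHGeodesic Ω x y γ)
    {c : ℝ} (hc : 1 ≤ c) (hu : IsQHUniform c Ω) :
    IsUniformCurve (geodesicConst c) Ω x y γ := by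
  have hp := h.profile hΩ hc hu
  have hb := h.len_ne_top hΩ
  have h1 : 0 ≤ 2 * (8 * c ^ 2 + 1) * Real.exp (8 * c ^ 2 + 1) := by positivity
  have h2 : 0 ≤ 4 * (8 * c ^ 2 + 1) + Real.exp (c * Real.log (2 + 4 * (8 * c ^ 2 + 1))) *
      c * (1 + 4 * (8 * c ^ 2 + 1)) := by positivity
  have hle : ∀ s t r : ℝ, 0 ≤ s → s ≤ t → t ≤ 1 →
      (len γ 0 t).toReal - (len γ 0 s).toReal ≤ r → len γ s t ≤ ENNReal.ofReal r := by
    intro s t r hs hst ht hr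
    rw [len_sub_len hb hs hst ht] at hr
    have hne : len γ s t ≠ ∞ := ne_top_of_le_ne_top hb (len_mono hs ht)
    rw [← ENNReal.ofReal_toReal hne]
    exact ENNReal.ofReal_le_ofReal hr
  refine ⟨h.toIsPathIn, ?_, fun t ht => ?_⟩
  · refine hle 0 1 _ le_rfl zero_le_one le_rfl (hp.length_le.trans ?_)
    refine mul_le_mul_of_nonneg_right ?_ dist_nonneg
    rw [geodesicConst]
    linarith
  · have hD : 2 * (8 * c ^ 2 + 1) * Real.exp (8 * c ^ 2 + 1) * bdist Ω (γ t) ≤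
        geodesicConst c * bdist Ω (γ t) := by
      refine mul_le_mul_of_nonneg_right ?_ bdist_nonneg
      rw [geodesicConst]
      linarith
    rcases hp.min_length_le ht with h3 | h3
    · exact (min_le_left _ _).trans (hle 0 t _ le_rfl ht.1 ht.2 (h3.trans hD))
    · exact (min_le_right _ _).trans (hle t 1 _ ht.1 ht.2 le_rfl (h3.trans hD))

/-- In a quasihyperbolically uniform quasiconvex domain of a proper space any two points are joined
by a quasihyperbolic geodesic. -/
theorem IsQHUniform.exists_isQHGeodesic [ProperSpace X] {lam c₀ c : ℝ} (hlam : 0 < lam)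
    (hlam' : lam ≤ 1) (hc₀ : 1 ≤ c₀) (hΩ : IsQuasiconvexDomain lam c₀ Ω) (hc : 1 ≤ c)
    (hu : IsQHUniform c Ω) (hx : x ∈ Ω) (hy : y ∈ Ω) : ∃ γ : ℝ → X, IsQHGeodesic Ω x y γ := by
  rw [isQHUniform_iff (by linarith)] at hu
  exact hΩ.exists_isQHGeodesic hlam hlam' hc₀ hx
    (ne_top_of_le_ne_top (by finiteness) (hu x hx y hy))

theorem IsQHUniform.isUniform [ProperSpace X] {lam c₀ c : ℝ} (hlam : 0 < lam)
    (hlam' : lam ≤ 1) (hc₀ : 1 ≤ c₀) (hΩ : IsQuasiconvexDomain lam c₀ Ω) (hc : 1 ≤ c)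
    (hu : IsQHUniform c Ω) : IsUniform (geodesicConst c) Ω := by
  intro x hx y hy
  obtain ⟨γ, hγ⟩ := hu.exists_isQHGeodesic hlam hlam' hc₀ hΩ hc hx hy
  exact ⟨γ, hγ.isUniformCurve hΩ.toIsDomainWithBoundary hc hu⟩

end Geodesic

end QHUniform

end

/-! ### The quantitative equivalences -/

theorem theorem3p2 (lam₀ c₀ : ℝ) (hlam₀ : 0 < lam₀) (hlam₀' : lam₀ ≤ 1) (hc₀ : 1 ≤ c₀) :
    -- (1) implies (2), quantitatively
    (∀ c : ℝ, 1 ≤ c → ∃ C : ℝ, 1 ≤ C ∧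
      ∀ (X : Type u) [MetricSpace X] [ProperSpace X] (Ω : Set X),
        QHUniform.IsQuasiconvexDomain lam₀ c₀ Ω →
        QHUniform.IsUniform c Ω → QHUniform.IsQHUniform C Ω) ∧
    -- (2) implies (1), quantitatively, with quasihyperbolic geodesics as uniform curves
    (∀ c : ℝ, 1 ≤ c → ∃ C : ℝ, 1 ≤ C ∧
      ∀ (X : Type u) [MetricSpace X] [ProperSpace X] (Ω : Set X),
        QHUniform.IsQuasiconvexDomain lam₀ c₀ Ω →
        QHUniform.IsQHUniform c Ω →
          QHUniform.IsUniform C Ω ∧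
          (∀ x ∈ Ω, ∀ y ∈ Ω, ∃ γ : ℝ → X, QHUniform.IsQHGeodesic Ω x y γ) ∧
          (∀ x ∈ Ω, ∀ y ∈ Ω, ∀ γ : ℝ → X, QHUniform.IsQHGeodesic Ω x y γ →
            QHUniform.IsUniformCurve C Ω x y γ)) ∧
    -- (1) implies (3), quantitatively
    (∀ c : ℝ, 1 ≤ c → ∃ C C' : ℝ, 1 ≤ C ∧ 0 ≤ C' ∧
      ∀ (X : Type u) [MetricSpace X] [ProperSpace X] (Ω : Set X),
        QHUniform.IsQuasiconvexDomain lam₀ c₀ Ω →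
        QHUniform.IsUniform c Ω → QHUniform.QHBound C C' Ω) ∧
    -- (3) implies (1), quantitatively
    (∀ c c' : ℝ, ∃ C : ℝ, 1 ≤ C ∧
      ∀ (X : Type u) [MetricSpace X] [ProperSpace X] (Ω : Set X),
        QHUniform.IsQuasiconvexDomain lam₀ c₀ Ω →
        QHUniform.QHBound c c' Ω → QHUniform.IsUniform C Ω) ∧
    -- (2) implies (3), quantitatively
    (∀ c : ℝ, 1 ≤ c → ∃ C C' : ℝ, 1 ≤ C ∧ 0 ≤ C' ∧
      ∀ (X : Type u) [MetricSpace X] [ProperSpace X] (Ω : Set X),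
        QHUniform.IsQuasiconvexDomain lam₀ c₀ Ω →
        QHUniform.IsQHUniform c Ω → QHUniform.QHBound C C' Ω) ∧
    -- (3) implies (2), quantitatively
    (∀ c c' : ℝ, ∃ C : ℝ, 1 ≤ C ∧
      ∀ (X : Type u) [MetricSpace X] [ProperSpace X] (Ω : Set X),
        QHUniform.IsQuasiconvexDomain lam₀ c₀ Ω →
        QHUniform.QHBound c c' Ω → QHUniform.IsQHUniform C Ω) := by
  -- The summand `4c₀` ensures this even for negative `c` and `c'`; (3) implies (1) passes through
  -- (2), where the constant must be at least `1`.
  have hC : ∀ c c' : ℝ, 1 ≤ max c 0 + max c' 0 / Real.log (1 + lam₀ / (2 * c₀)) + 4 * c₀ := by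
    intro c c'
    have ha : 0 < lam₀ / (2 * c₀) := by positivity
    have hlog : 0 < Real.log (1 + lam₀ / (2 * c₀)) := Real.log_pos (by linarith)
    have : 0 ≤ max c 0 + max c' 0 / Real.log (1 + lam₀ / (2 * c₀)) := by positivity
    linarith
  have hC6 : ∀ c : ℝ, 1 ≤ c → 1 ≤ 6 * c ^ 2 := fun c hc => by nlinarith
  refine ⟨fun c hc => ⟨6 * c ^ 2, hC6 c hc, fun X _ _ Ω hΩ hu => ?_⟩,
    fun c hc => ⟨QHUniform.geodesicConst c, QHUniform.one_le_geodesicConst hc,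
      fun X _ _ Ω hΩ hu => ⟨?_, fun x hx y hy => ?_, fun x hx y hy γ hγ => ?_⟩⟩,
    fun c hc => ⟨6 * c ^ 2, 0, hC6 c hc, le_rfl, fun X _ _ Ω hΩ hu => ?_⟩,
    fun c c' => ⟨_, QHUniform.one_le_geodesicConst (hC c c'), fun X _ _ Ω hΩ hb => ?_⟩,
    fun c hc => ⟨c, 0, hc, le_rfl, fun X _ _ Ω hΩ hu => hu.qhBound⟩,
    fun c c' => ⟨_, hC c c', fun X _ _ Ω hΩ hb => hb.isQHUniform hlam₀ hlam₀' hc₀ hΩ⟩⟩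
  · exact hu.isQHUniform hc hΩ.toIsDomainWithBoundary
  · exact hu.isUniform hlam₀ hlam₀' hc₀ hΩ hc
  · exact hu.exists_isQHGeodesic hlam₀ hlam₀' hc₀ hΩ hc hx hy
  · exact hγ.isUniformCurve hΩ.toIsDomainWithBoundary hc hu
  · exact (hu.isQHUniform hc hΩ.toIsDomainWithBoundary).qhBound
  · exact (hb.isQHUniform hlam₀ hlam₀' hc₀ hΩ).isUniform hlam₀ hlam₀' hc₀ hΩ (hC c c')
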